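/- Throughout, $k$ is a field and all algebras are associative and unital; "noetherian" means left and right noetherian. Definitions. An $\mathbb N$-filtration $\mathcal F$ of an algebra $A$ over a commutative ring $R$ is an ascending chain of $R$-submodules $\mathcal F_0\subseteq\mathcal F_1\subseteq\cdots$ with $1\in\mathcal F_0$, $\mathcal F_i\mathcal F_j\subseteq\mathcal F_{i+j}$ and $\bigcup_n\mathcal F_n=A$; it is locally finite if every $\mathcal F_n$ is a finitely generated $R$-module, and $\operatorname{gr}_{\mathcal F}A=\bigoplus_n\mathcal F_n/\mathcal F_{n-1}$ (with $\mathcal F_{-1}=0$); a graded $R$-algebra is locally finite if each of its components is a finitely generated $R$-module. If $D\subseteq k$ is a subring, an order of a $k$-algebra $A$ over $D$ is a $D$-subalgebra $A_D\subseteq A$ that is free as a $D$-module and for which the multiplication map $A_D\otimes_D k\to A$ is bijective. An $R$-algebra $B$ is strongly noetherian (respectively universally noetherian) over $R$ if $B\otimes_R C$ is noetherian for every commutative noetherian $R$-algebra $C$ (respectively for every noetherian $R$-algebra $C$, commutative or not). A $k$-algebra $A$ with an $\mathbb N$-filtration $\mathcal F$ is congenial if $\mathcal F$ is locally finite and there are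 a subring $D\subseteq k$, finitely generated as a ring, and an order $A_D$ of $A$ over $D$ such that 1. the induced filtration $(\mathcal F_n\cap A_D)_n$ of the $D$-algebra $A_D$ is locally finite; 2. $\operatorname{gr}A_D$, formed with the induced filtration and mapped canonically and injectively to $\operatorname{gr}_{\mathcal F}A$, is an order of $\operatorname{gr}_{\mathcal F}A$ over $D$; 3. $\operatorname{gr}A_D$ is a strongly noetherian locally finite graded $D$-algebra; 4. for every factor ring $F$ of $D$ that is a finite field, $A_D\otimes_D F$ is a finitely generated noetherian $F$-algebra that satisfies a nonzero polynomial identity over $F$. Theorem. Let $A_1$ and $A_2$ be $k$-algebras that are congenial with respect to $\mathbb N$-filtrations $\mathcal F_1$ and $\mathcal F_2$. Suppose that the congeniality of $A_1$ is witnessed by a subring $D_1\subseteq k$ and an order $(A_1)_{D_1}$ for which $\operatorname{gr}\,(A_1)_{D_1}$ is universally noetherian over $D_1$. Then $A_1\otimes_k A_2$ is congenial with respect to the tensor-sum filtration $\mathcal F$, where $\mathcal F_n$ is the $k$-span of all $a_1\otimes a_2$ with $a_1\in(\mathcal F_1)_r$, $a_2\in(\mathcal F_2)_s$ and $r+s\le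 n$. -/

import Mathlib

open scoped DirectSum TensorProduct

universe u

/-- An `ℕ`-filtration of the `R`-algebra `A`: an exhaustive ascending chain
`F 0 ≤ F 1 ≤ ⋯` of `R`-submodules with `1 ∈ F 0` and `F i * F j ≤ F (i + j)`. -/
structure AlgFiltration (R : Type*) (A : Type*) [CommRing R] [Ring A] [Algebra R A] where
  toFun : ℕ → Submodule R A
  mono' : Monotone toFun
  one_mem' : (1 : A) ∈ toFun 0
  mul_mem' : ∀ {i j : ℕ} {a b : A}, a ∈ toFun i → b ∈ toFun j → a * b ∈ toFun (i + j)
  exhaustive' : ∀ a : A, ∃ n, a ∈ toFun n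

namespace AlgFiltration

section Gr

variable {R A : Type*} [CommRing R] [Ring A] [Algebra R A] (F : AlgFiltration R A)

/-- The previous layer `F (n - 1)`, with `F (-1) = 0`. -/
def pred : ℕ → Submodule R A
  | 0 => ⊥
  | n + 1 => F.toFun n

theorem mul_mem_pred_left {i j : ℕ} {a b : A} (ha : a ∈ F.pred i) (hb : b ∈ F.toFun j) :
    a * b ∈ F.pred (i + j) := by
  cases i with
  | zero =>
    have h0 : a = 0 := by simpa [pred] using ha
    simp [h0]
  | succ i =>
    have h := F.mul_mem' (i := i) ha hb
    rw [Nat.succ_add]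
    exact h

theorem mul_mem_pred_right {i j : ℕ} {a b : A} (ha : a ∈ F.toFun i) (hb : b ∈ F.pred j) :
    a * b ∈ F.pred (i + j) := by
  cases j with
  | zero =>
    have h0 : b = 0 := by simpa [pred] using hb
    simp [h0]
  | succ j => exact F.mul_mem' (j := j) ha hb

/-- The component `F n / F (n - 1)` of the associated graded algebra. -/
def GrPiece (n : ℕ) : Type _ := ↥(F.toFun n) ⧸ (F.pred n).submoduleOf (F.toFun n)

instance instGrPieceAddCommGroup (n : ℕ) : AddCommGroup (F.GrPiece n) :=
  inferInstanceAs (AddCommGroup (↥(F.toFun n) ⧸ (F.pred n).submoduleOf (F.toFun n)))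

/-- `F n / F (n - 1)` is a module over `R`, and over every commutative ring `S` over which `R`
and `A` are compatibly algebras. -/
instance instGrPieceModule {S : Type*} [CommRing S] [Algebra S R] [Algebra S A]
    [IsScalarTower S R A] (n : ℕ) : Module S (F.GrPiece n) :=
  Submodule.Quotient.module' ((F.pred n).submoduleOf (F.toFun n))

instance instGrPieceIsScalarTower {S : Type*} [CommRing S] [Algebra S R] [Algebra S A]
    [IsScalarTower S R A] (n : ℕ) : IsScalarTower S R (F.GrPiece n) where
  smul_assoc s r x := by
    obtain ⟨x, rfl⟩ := Submodule.Quotient.mk_surjective _ x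
    exact congrArg (Submodule.Quotient.mk (p := (F.pred n).submoduleOf (F.toFun n)))
      (smul_assoc s r x)

/-- The quotient map `F n → F n / F (n - 1)`. -/
def grMk (n : ℕ) : F.toFun n →ₗ[R] F.GrPiece n where
  toFun x := Submodule.Quotient.mk (p := (F.pred n).submoduleOf (F.toFun n)) x
  map_add' _ _ := rfl
  map_smul' _ _ := rfl

theorem grMk_surjective (n : ℕ) : Function.Surjective (F.grMk n) :=
  Submodule.Quotient.mk_surjective _

theorem grMk_eq_zero {n : ℕ} {x : F.toFun n} (hx : (x : A) ∈ F.pred n) : F.grMk n x = 0 :=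
  (Submodule.Quotient.mk_eq_zero _).2 hx

theorem grMk_heq {i j : ℕ} (h : i = j) (x : F.toFun i) (y : F.toFun j) (hxy : (x : A) = y) :
    GradedMonoid.mk (A := F.GrPiece) i (F.grMk i x) = GradedMonoid.mk j (F.grMk j y) := by
  subst h
  have hx : x = y := Subtype.ext hxy
  rw [hx]

/-- Multiplication `F i × F j → F (i + j)`. -/
def layerMul (i j : ℕ) : F.toFun i →ₗ[R] F.toFun j →ₗ[R] F.toFun (i + j) :=
  LinearMap.mk₂ R (fun a b => ⟨(a : A) * b, F.mul_mem' a.2 b.2⟩)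
    (fun a a' b => Subtype.ext (add_mul (a : A) a' b))
    (fun c a b => Subtype.ext (smul_mul_assoc c (a : A) b))
    (fun a b b' => Subtype.ext (mul_add (a : A) b b'))
    (fun c a b => Subtype.ext (mul_smul_comm c (a : A) b))

/-- The linear map out of `F n / F (n - 1)` induced by a linear map that kills `F (n - 1)`. -/
def grLift {M : Type*} [AddCommGroup M] [Module R M] {n : ℕ} (g : F.toFun n →ₗ[R] M)
    (hg : ∀ x : F.toFun n, (x : A) ∈ F.pred n → g x = 0) : F.GrPiece n →ₗ[R] M :=
  Submodule.liftQ ((F.pred n).submoduleOf (F.toFun n)) g hg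

/-- The product of the classes of `a` and `b` is the class of `a * b`. -/
def grMul (i j : ℕ) : F.GrPiece i →ₗ[R] F.GrPiece j →ₗ[R] F.GrPiece (i + j) :=
  F.grLift
    (LinearMap.flip (F.grLift
      (LinearMap.flip ((F.layerMul i j).compr₂ (F.grMk (i + j))))
      (fun _ hb => LinearMap.ext fun a => F.grMk_eq_zero (F.mul_mem_pred_right a.2 hb))))
    (fun a ha => LinearMap.ext fun b => by
      obtain ⟨b, rfl⟩ := F.grMk_surjective _ b
      exact F.grMk_eq_zero (F.mul_mem_pred_left ha b.2))

theorem grMul_mk {i j : ℕ} (a : F.toFun i) (b : F.toFun j) :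
    F.grMul i j (F.grMk i a) (F.grMk j b) =
      F.grMk (i + j) ⟨(a : A) * b, F.mul_mem' a.2 b.2⟩ := rfl

instance instGOne : GradedMonoid.GOne F.GrPiece where
  one := F.grMk 0 ⟨1, F.one_mem'⟩

instance instGMul : GradedMonoid.GMul F.GrPiece where
  mul {i j} a b := F.grMul i j a b

instance instGRing : DirectSum.GRing F.GrPiece where
  mul_zero a := map_zero (F.grMul _ _ a)
  zero_mul b := by
    change F.grMul _ _ 0 b = 0
    simp
  mul_add a b c := map_add (F.grMul _ _ a) b c
  add_mul a b c := by
    change F.grMul _ _ (a + b) c = F.grMul _ _ a c + F.grMul _ _ b c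
    simp
  one_mul := by
    rintro ⟨i, a⟩
    obtain ⟨a, rfl⟩ := F.grMk_surjective _ a
    exact F.grMk_heq (zero_add i) _ _ (one_mul (a : A))
  mul_one := by
    rintro ⟨i, a⟩
    obtain ⟨a, rfl⟩ := F.grMk_surjective _ a
    exact F.grMk_heq (add_zero i) _ _ (mul_one (a : A))
  mul_assoc := by
    rintro ⟨i, a⟩ ⟨j, b⟩ ⟨l, c⟩
    obtain ⟨a, rfl⟩ := F.grMk_surjective _ a
    obtain ⟨b, rfl⟩ := F.grMk_surjective _ b
    obtain ⟨c, rfl⟩ := F.grMk_surjective _ c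
    exact F.grMk_heq (add_assoc i j l) _ _ (mul_assoc (a : A) b c)
  natCast n := n • F.grMk 0 ⟨1, F.one_mem'⟩
  natCast_zero := zero_smul _ _
  natCast_succ n := succ_nsmul _ n
  intCast n := n • F.grMk 0 ⟨1, F.one_mem'⟩
  intCast_ofNat n := natCast_zsmul _ n
  intCast_negSucc_ofNat n := negSucc_zsmul _ n

/-- The associated graded algebra `⨁ n, F n / F (n - 1)`. -/
def Gr : Type _ := ⨁ n, F.GrPiece n

instance instGrRing : Ring F.Gr := DirectSum.ring F.GrPiece

section Scalars

variable {S : Type*} [CommRing S] [Algebra S R] [Algebra S A] [IsScalarTower S R A]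

/-- The associated graded algebra is an algebra over `R`, and also over every commutative ring
`S` over which `R` and `A` are compatibly algebras. -/
instance instGAlgebra : DirectSum.GAlgebra S F.GrPiece where
  toFun :=
    { toFun := fun s => s • F.grMk 0 ⟨1, F.one_mem'⟩
      map_zero' := zero_smul _ _
      map_add' := fun s t => add_smul s t _ }
  map_one := one_smul _ _
  map_mul r s := by
    refine F.grMk_heq (zero_add 0).symm ((r * s) • (⟨1, F.one_mem'⟩ : F.toFun 0))
      ⟨(r • (1 : A)) * (s • (1 : A)), _⟩ ?_
    change (r * s) • (1 : A) = (r • (1 : A)) * (s • (1 : A))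
    rw [smul_mul_smul_comm, mul_one]
  commutes r := by
    rintro ⟨i, a⟩
    obtain ⟨a, rfl⟩ := F.grMk_surjective _ a
    refine F.grMk_heq (add_comm 0 i) ⟨(r • (1 : A)) * a, _⟩ ⟨(a : A) * (r • (1 : A)), _⟩ ?_
    simp
  smul_def r := by
    rintro ⟨i, a⟩
    obtain ⟨a, rfl⟩ := F.grMk_surjective _ a
    refine F.grMk_heq (zero_add i).symm (r • a) ⟨(r • (1 : A)) * a, _⟩ ?_
    change r • (a : A) = (r • (1 : A)) * a
    simp

instance instGrAlgebra : Algebra S F.Gr :=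
  inferInstanceAs (Algebra S (⨁ n, F.GrPiece n))

instance instGrIsScalarTower : IsScalarTower S R F.Gr :=
  inferInstanceAs (IsScalarTower S R (⨁ n, F.GrPiece n))

end Scalars

/-- Every layer of the filtration is a finitely generated module. -/
def LocallyFinite : Prop := ∀ n, Module.Finite R (F.toFun n)

/-- Every component of the associated graded algebra is a finitely generated module. -/
def GrLocallyFinite : Prop := ∀ n, Module.Finite R (F.GrPiece n)

end Gr

section Induced

variable {R A : Type*} [CommRing R] [Ring A] [Algebra R A] (F : AlgFiltration R A)
variable {S : Type*} [CommRing S] [Algebra S R] [Algebra S A] [IsScalarTower S R A]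

/-- The filtration `F n ∩ B` induced on an `S`-subalgebra `B` of `A`. -/
def induced (B : Subalgebra S A) : AlgFiltration S B where
  toFun n := ((F.toFun n).restrictScalars S).comap B.val.toLinearMap
  mono' _ _ h _ hx := F.mono' h hx
  one_mem' := F.one_mem'
  mul_mem' ha hb := F.mul_mem' ha hb
  exhaustive' b := F.exhaustive' (b : A)

theorem induced_pred_val (B : Subalgebra S A) {n : ℕ} {b : B}
    (hb : b ∈ (F.induced B).pred n) : (b : A) ∈ F.pred n := by
  cases n with
  | zero =>
    have h0 : b = 0 := by simpa [pred] using hb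
    simp [h0]
  | succ n => exact hb

/-- The inclusion `F n ∩ B → F n`. -/
def layerIncl (B : Subalgebra S A) (n : ℕ) : (F.induced B).toFun n →ₗ[S] F.toFun n where
  toFun b := ⟨((b : B) : A), b.2⟩
  map_add' _ _ := rfl
  map_smul' _ _ := rfl

/-- The map `(F n ∩ B) / (F (n - 1) ∩ B) → F n / F (n - 1)` induced by the inclusion. -/
def grPieceIncl (B : Subalgebra S A) (n : ℕ) : (F.induced B).GrPiece n →ₗ[S] F.GrPiece n :=
  (F.induced B).grLift (((F.grMk n).restrictScalars S).comp (F.layerIncl B n))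
    (fun _ hb => F.grMk_eq_zero (F.induced_pred_val B hb))

theorem grPieceIncl_mk (B : Subalgebra S A) (n : ℕ) (b : (F.induced B).toFun n) :
    F.grPieceIncl B n ((F.induced B).grMk n b) = F.grMk n ⟨((b : B) : A), b.2⟩ := rfl

/-- The canonical homomorphism `gr B → gr A` for an `S`-subalgebra `B` of `A` with the induced
filtration. -/
noncomputable def grIncl (B : Subalgebra S A) : (F.induced B).Gr →ₐ[S] F.Gr :=
  DirectSum.toAlgebra S (F.induced B).GrPiece
    (fun n => (DirectSum.lof S ℕ F.GrPiece n).comp (F.grPieceIncl B n))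
    rfl
    (by
      intro i j a b
      obtain ⟨a, rfl⟩ := (F.induced B).grMk_surjective _ a
      obtain ⟨b, rfl⟩ := (F.induced B).grMk_surjective _ b
      exact (DirectSum.of_mul_of (A := F.GrPiece)
        (F.grPieceIncl B i ((F.induced B).grMk i a))
        (F.grPieceIncl B j ((F.induced B).grMk j b))).symm)

end Induced

section Tensor

variable {k A₁ A₂ : Type*} [CommRing k] [Ring A₁] [Ring A₂] [Algebra k A₁] [Algebra k A₂]

/-- The tensor-sum filtration on `A₁ ⊗ A₂`: its `n`-th layer is spanned by the tensors `a ⊗ b`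
with `a ∈ F₁ r`, `b ∈ F₂ s` and `r + s ≤ n`. -/
def tensor (F₁ : AlgFiltration k A₁) (F₂ : AlgFiltration k A₂) :
    AlgFiltration k (A₁ ⊗[k] A₂) where
  toFun n := Submodule.span k
    {t | ∃ r s : ℕ, r + s ≤ n ∧ ∃ a ∈ F₁.toFun r, ∃ b ∈ F₂.toFun s, a ⊗ₜ[k] b = t}
  mono' := by
    intro m n hmn
    refine Submodule.span_mono ?_
    rintro t ⟨r, s, hrs, h⟩
    exact ⟨r, s, hrs.trans hmn, h⟩
  one_mem' := Submodule.subset_span ⟨0, 0, le_rfl, 1, F₁.one_mem', 1, F₂.one_mem', rfl⟩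
  mul_mem' := by
    intro i j x y hx hy
    have h := Submodule.mul_mem_mul hx hy
    rw [Submodule.span_mul_span] at h
    refine Submodule.span_mono ?_ h
    rintro _ ⟨_, ⟨r, s, hrs, a, ha, b, hb, rfl⟩, _, ⟨r', s', hrs', a', ha', b', hb', rfl⟩, rfl⟩
    exact ⟨r + r', s + s', by omega, a * a', F₁.mul_mem' ha ha', b * b', F₂.mul_mem' hb hb',
      (Algebra.TensorProduct.tmul_mul_tmul a a' b b').symm⟩
  exhaustive' := by
    intro x
    induction x using TensorProduct.induction_on with
    | zero => exact ⟨0, Submodule.zero_mem _⟩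
    | tmul a b =>
      obtain ⟨r, hr⟩ := F₁.exhaustive' a
      obtain ⟨s, hs⟩ := F₂.exhaustive' b
      exact ⟨r + s, Submodule.subset_span ⟨r, s, le_rfl, a, hr, b, hs, rfl⟩⟩
    | add x y hx hy =>
      obtain ⟨m, hm⟩ := hx
      obtain ⟨n, hn⟩ := hy
      refine ⟨max m n, Submodule.add_mem _ ?_ ?_⟩
      · refine Submodule.span_mono ?_ hm
        rintro t ⟨r, s, hrs, h⟩
        exact ⟨r, s, hrs.trans (le_max_left m n), h⟩
      · refine Submodule.span_mono ?_ hn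
        rintro t ⟨r, s, hrs, h⟩
        exact ⟨r, s, hrs.trans (le_max_right m n), h⟩

end Tensor

end AlgFiltration

/-- A (not necessarily commutative) ring that is left and right noetherian. -/
structure IsNoethRing (A : Type*) [Ring A] : Prop where
  left : IsNoetherianRing A
  right : IsNoetherianRing Aᵐᵒᵖ

/-- `A ⊗_R C` is noetherian for every commutative noetherian `R`-algebra `C`. -/
def IsStronglyNoetherian (R A : Type u) [CommRing R] [Ring A] [Algebra R A] : Prop :=
  ∀ (C : Type u) [CommRing C] [Algebra R C], IsNoetherianRing C → IsNoethRing (A ⊗[R] C)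

/-- `A ⊗_R C` is noetherian for every noetherian `R`-algebra `C`, commutative or not. -/
def IsUniversallyNoetherian (R A : Type u) [CommRing R] [Ring A] [Algebra R A] : Prop :=
  ∀ (C : Type u) [Ring C] [Algebra R C], IsNoethRing C → IsNoethRing (A ⊗[R] C)

/-- A polynomial identity algebra over a field `K`: some nonzero noncommutative polynomial over
`K` vanishes under every substitution of elements of `A` for its variables. -/
def IsPIAlgebra (K A : Type*) [Field K] [Ring A] [Algebra K A] : Prop :=
  ∃ f : FreeAlgebra K ℕ, f ≠ 0 ∧ ∀ x : ℕ → A, FreeAlgebra.lift K x f = 0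

/-- The `D`-algebra `B`, regarded as a `D`-subalgebra of the `k`-algebra `A` through the injective
homomorphism `f`, is an order of `A`: it is free over `D`, and the multiplication map
`k ⊗_D B → A` is bijective. -/
structure IsOrder (k : Type*) {D A B : Type*} [CommRing k] [CommRing D] [Algebra D k] [Ring A]
    [Algebra k A] [Algebra D A] [IsScalarTower D k A] [Ring B] [Algebra D B]
    (f : B →ₐ[D] A) : Prop where
  injective : Function.Injective f
  free : Module.Free D B
  baseChange : IsBaseChange k f.toLinearMap

namespace AlgFiltration

variable {k A : Type u} [Field k] [Ring A] [Algebra k A]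

/-- The filtered algebra `A` is congenial, as witnessed by the finitely generated subring `D` of
`k` and the `D`-subalgebra `B` of `A`. In `reduction`, `K` is a finite field that is a factor
ring of `D`. -/
structure IsCongenialWith (F : AlgFiltration k A) (D : Subalgebra ℤ k)
    (B : Subalgebra D A) : Prop where
  affine : D.FG
  locallyFinite : F.LocallyFinite
  order : IsOrder k B.val
  order_locallyFinite : (F.induced B).LocallyFinite
  gr_order : IsOrder k (F.grIncl B)
  gr_stronglyNoetherian : IsStronglyNoetherian D (F.induced B).Gr
  gr_locallyFinite : (F.induced B).GrLocallyFinite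
  reduction : ∀ (K : Type u) [Field K] [Finite K] [Algebra D K],
    Function.Surjective (algebraMap D K) →
      Algebra.FiniteType K (K ⊗[D] B) ∧ IsNoethRing (K ⊗[D] B) ∧ IsPIAlgebra K (K ⊗[D] B)

/-- The `k`-algebra `A` is congenial with respect to the filtration `F`. -/
def IsCongenial (F : AlgFiltration k A) : Prop :=
  ∃ (D : Subalgebra ℤ k) (B : Subalgebra D A), F.IsCongenialWith D B

end AlgFiltration

/-!
Let `B₁` and `B₂` be orders of `A₁` and `A₂` over `D₁` and `D₂` that witness congeniality, and let
`D = D₁ ⊔ D₂`. The `D`-subalgebra `B` of `A₁ ⊗ A₂` generated by `B₁` and `B₂` is an order, since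
the products of basis elements form a basis. Over a field `gr (A₁ ⊗ A₂) = gr A₁ ⊗ gr A₂`, so that
`gr B`, formed with the product of the filtrations of `B₁` and `B₂`, is in the same way an order of
`gr (A₁ ⊗ A₂)`. In particular it embeds into `gr (A₁ ⊗ A₂)`, which forces the product filtration on
`B` to be the induced one.

After a base change to a commutative noetherian `D`-algebra `C`, `gr B` is a quotient of
`gr B₁ ⊗ (C ⊗ gr B₂)`. The second factor is noetherian because `gr B₂` is strongly noetherian, and
the whole because `gr B₁` is universally noetherian. For a finite field `K`, the noetherian
property of `K ⊗ B` lifts from an associated graded algebra that is a quotient of the same kind.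

Polynomial identities in `K ⊗ B` are provided by Regev's theorem. By Latyshev's argument, an
identity of degree `d` allows the `n!` products of `n` generic elements in all orders to be
expressed through those without a decreasing subsequence of length `d`, of which there are at most
`d ^ (2 * n)`. The products of such elements for the two factors are therefore fewer than `n!` for
large `n`, and a linear dependence between the `n!` products in the tensor product is an identity.
-/

/-! ### Filtrations and associated graded algebras -/

namespace AlgFiltration

section SymbolMap

variable {R A : Type*} [CommRing R] [Ring A] [Algebra R A] (F : AlgFiltration R A)

theorem toFun_le_pred {m n : ℕ} (h : m < n) : F.toFun m ≤ F.pred n := by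
  cases n with
  | zero => omega
  | succ n => exact F.mono' (Nat.lt_succ_iff.1 h)

theorem ext_toFun {F G : AlgFiltration R A} (h : ∀ n, F.toFun n = G.toFun n) : F = G := by
  cases F
  cases G
  congr
  exact funext h

/-- The principal symbol of degree `n`: the class in `gr A` of an element of the `n`-th layer. -/
def cls (n : ℕ) : F.toFun n →ₗ[R] F.Gr := (DirectSum.lof R ℕ F.GrPiece n).comp (F.grMk n)

theorem cls_mul {i j : ℕ} (a : F.toFun i) (b : F.toFun j) :
    F.cls i a * F.cls j b = F.cls (i + j) ⟨(a : A) * b, F.mul_mem' a.2 b.2⟩ :=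
  DirectSum.of_mul_of (A := F.GrPiece) (F.grMk i a) (F.grMk j b)

theorem cls_congr {i j : ℕ} (h : i = j) {a : F.toFun i} {b : F.toFun j} (hab : (a : A) = b) :
    F.cls i a = F.cls j b := by
  subst h
  rw [Subtype.ext hab]

theorem grMk_eq_zero_iff {n : ℕ} {x : F.toFun n} : F.grMk n x = 0 ↔ (x : A) ∈ F.pred n :=
  Submodule.Quotient.mk_eq_zero _

theorem cls_eq_zero_iff {n : ℕ} {a : F.toFun n} : F.cls n a = 0 ↔ (a : A) ∈ F.pred n := by
  rw [← grMk_eq_zero_iff]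
  exact (DirectSum.of_injective (β := F.GrPiece) n).eq_iff' (map_zero _)

theorem gr_induction {p : F.Gr → Prop} (zero : p 0) (add : ∀ x y, p x → p y → p (x + y))
    (cls : ∀ n a, p (F.cls n a)) (x : F.Gr) : p x := by
  refine DirectSum.induction_on (motive := p) x zero (fun n a => ?_) add
  obtain ⟨a, rfl⟩ := F.grMk_surjective n a
  exact cls n a

/-- The linear map out of `gr A` induced by a family of linear maps on the layers, each of which
kills the previous layer. -/
noncomputable def grDesc {M : Type*} [AddCommGroup M] [Module R M] (g : ∀ n, F.toFun n →ₗ[R] M)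
    (hg : ∀ n (x : F.toFun n), (x : A) ∈ F.pred n → g n x = 0) : F.Gr →ₗ[R] M :=
  DirectSum.toModule R ℕ M fun n => F.grLift (g n) (hg n)

theorem grDesc_cls {M : Type*} [AddCommGroup M] [Module R M] (g : ∀ n, F.toFun n →ₗ[R] M)
    (hg : ∀ n (x : F.toFun n), (x : A) ∈ F.pred n → g n x = 0) (n : ℕ) (a : F.toFun n) :
    F.grDesc g hg (F.cls n a) = g n a :=
  DirectSum.toModule_lof R n (F.grMk n a)

theorem LocallyFinite.gr {F : AlgFiltration R A} (hF : F.LocallyFinite) : F.GrLocallyFinite :=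
  fun n => by
    have := hF n
    exact Module.Finite.of_surjective (F.grMk n) (F.grMk_surjective n)

end SymbolMap

section FilteredHom

variable {S R A B : Type*} [CommRing S] [CommRing R] [Ring A] [Ring B] [Algebra R A]
  [Algebra S A] [Algebra S B] {G : AlgFiltration S B} {F : AlgFiltration R A} {f : B →ₐ[S] A}

/-- A homomorphism of filtered algebras, where the filtration of the target may be linear over a
larger ring of scalars. -/
def IsFilteredHom (G : AlgFiltration S B) (F : AlgFiltration R A) (f : B →ₐ[S] A) : Prop :=
  ∀ n, ∀ b ∈ G.toFun n, f b ∈ F.toFun n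

theorem IsFilteredHom.map_mem_pred (hf : G.IsFilteredHom F f) {n : ℕ} {b : B}
    (hb : b ∈ G.pred n) : f b ∈ F.pred n := by
  cases n with
  | zero =>
    rw [(Submodule.mem_bot S).1 hb, map_zero]
    exact Submodule.zero_mem _
  | succ n => exact hf n b hb

variable [Algebra S R] [IsScalarTower S R A]

theorem isFilteredHom_val (F : AlgFiltration R A) (B : Subalgebra S A) :
    (F.induced B).IsFilteredHom F B.val :=
  fun _ _ hb => hb

/-- The map on `n`-th layers induced by a filtered homomorphism. -/
def IsFilteredHom.layerMap (hf : G.IsFilteredHom F f) (n : ℕ) : G.toFun n →ₗ[S] F.toFun n :=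
  f.toLinearMap.restrict (q := (F.toFun n).restrictScalars S) (hf n)

/-- The homomorphism of associated graded algebras induced by a filtered homomorphism. -/
noncomputable def IsFilteredHom.grMap (hf : G.IsFilteredHom F f) : G.Gr →ₐ[S] F.Gr :=
  DirectSum.toAlgebra S G.GrPiece
    (fun n => (DirectSum.lof S ℕ F.GrPiece n).comp
      (G.grLift (((F.grMk n).restrictScalars S).comp (hf.layerMap n))
        fun _ hx => F.grMk_eq_zero (hf.map_mem_pred hx)))
    (congrArg (F.cls 0) (Subtype.ext (map_one f)))
    (by
      intro i j a b
      obtain ⟨a, rfl⟩ := G.grMk_surjective _ a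
      obtain ⟨b, rfl⟩ := G.grMk_surjective _ b
      refine Eq.trans ?_ (F.cls_mul (hf.layerMap i a) (hf.layerMap j b)).symm
      exact congrArg (F.cls (i + j)) (Subtype.ext (map_mul f (a : B) b)))

theorem IsFilteredHom.grMap_cls (hf : G.IsFilteredHom F f) (n : ℕ) (b : G.toFun n) :
    hf.grMap (G.cls n b) = F.cls n ⟨f b, hf n b b.2⟩ :=
  DirectSum.toAddMonoid_of _ _ _

theorem IsFilteredHom.grMap_grMap_of_comm {S' T B' C : Type*} [CommRing S'] [CommRing T] [Ring B']
    [Ring C] [Algebra S' B'] [Algebra S' A] [Algebra S' R] [IsScalarTower S' R A] [Algebra T B]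
    [Algebra T B'] [Algebra T C] [Algebra T S] [Algebra T S'] [IsScalarTower T S B]
    [IsScalarTower T S' B'] {G' : AlgFiltration S' B'} {H : AlgFiltration T C} {f' : B' →ₐ[S'] A}
    {g : C →ₐ[T] B} {g' : C →ₐ[T] B'} (hf : G.IsFilteredHom F f) (hf' : G'.IsFilteredHom F f')
    (hg : H.IsFilteredHom G g) (hg' : H.IsFilteredHom G' g') (hcomm : ∀ c, f (g c) = f' (g' c))
    (x : H.Gr) : hf.grMap (hg.grMap x) = hf'.grMap (hg'.grMap x) := by
  induction x using H.gr_induction with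
  | zero => simp only [map_zero]
  | add x y hx hy => simp only [map_add, hx, hy]
  | cls n c =>
    simp only [grMap_cls]
    exact F.cls_congr rfl (hcomm c)

/-- Strictness: were `b` of filtration degree exactly `m > n`, its symbol of degree `m` would be a
nonzero element of the kernel. -/
theorem IsFilteredHom.mem_of_map_mem (hf : G.IsFilteredHom F f)
    (hinj : Function.Injective hf.grMap) {n : ℕ} {b : B} (hb : f b ∈ F.toFun n) :
    b ∈ G.toFun n := by
  obtain ⟨m, hm⟩ := G.exhaustive' b
  induction m with
  | zero => exact G.mono' n.zero_le hm
  | succ m ih =>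
    rcases le_or_gt (m + 1) n with hmn | hmn
    · exact G.mono' hmn hm
    · refine ih (G.cls_eq_zero_iff (a := ⟨b, hm⟩).1 (hinj ?_))
      rw [hf.grMap_cls, map_zero]
      exact F.cls_eq_zero_iff.2 (F.toFun_le_pred hmn hb)

end FilteredHom

section Noetherian

variable {R A : Type*} [CommRing R] [Ring A] [Algebra R A] (F : AlgFiltration R A)

/-- The projection of `gr A` onto its homogeneous component of degree `n`. -/
def component (n : ℕ) : F.Gr →+ F.GrPiece n :=
  DFinsupp.evalAddMonoidHom (β := F.GrPiece) n

theorem component_cls_self (n : ℕ) (a : F.toFun n) : F.component n (F.cls n a) = F.grMk n a :=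
  DirectSum.of_eq_same (β := F.GrPiece) _ _

theorem component_cls_of_ne {m n : ℕ} (h : m ≠ n) (a : F.toFun n) :
    F.component m (F.cls n a) = 0 :=
  DirectSum.of_eq_of_ne (β := F.GrPiece) _ _ _ h

/-- The associated graded subgroup `gr I ⊆ gr A` of an additive subgroup `I` of `A`: its component
of degree `n` consists of the symbols of the elements of `I` in the `n`-th layer. -/
def grAddSubgroup (I : AddSubgroup A) : AddSubgroup F.Gr where
  carrier := {x | ∀ n, ∃ a : F.toFun n, (a : A) ∈ I ∧ F.grMk n a = F.component n x}
  zero_mem' n := ⟨0, I.zero_mem, by rw [map_zero, map_zero]⟩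
  add_mem' {x y} hx hy n := by
    obtain ⟨a, ha, hax⟩ := hx n
    obtain ⟨b, hb, hby⟩ := hy n
    refine ⟨a + b, I.add_mem ha hb, ?_⟩
    rw [map_add, map_add, hax, hby]
  neg_mem' {x} hx n := by
    obtain ⟨a, ha, hax⟩ := hx n
    refine ⟨-a, I.neg_mem ha, ?_⟩
    rw [map_neg, map_neg, hax]

theorem cls_mem_grAddSubgroup_iff (I : AddSubgroup A) (n : ℕ) (a : F.toFun n) :
    F.cls n a ∈ F.grAddSubgroup I ↔ ∃ b : F.toFun n, (b : A) ∈ I ∧ (a : A) - b ∈ F.pred n := by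
  constructor
  · intro h
    obtain ⟨b, hb, hba⟩ := h n
    refine ⟨b, hb, ?_⟩
    rw [component_cls_self] at hba
    rw [← Submodule.coe_sub, ← grMk_eq_zero_iff, map_sub, hba, sub_self]
  · rintro ⟨b, hb, hba⟩ m
    rw [← Submodule.coe_sub, ← grMk_eq_zero_iff, map_sub, sub_eq_zero] at hba
    rcases eq_or_ne m n with rfl | hmn
    · exact ⟨b, hb, by rw [component_cls_self, hba]⟩
    · exact ⟨0, I.zero_mem, by rw [map_zero, component_cls_of_ne _ hmn]⟩

theorem cls_mem_grAddSubgroup {I : AddSubgroup A} {n : ℕ} {a : F.toFun n} (ha : (a : A) ∈ I) :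
    F.cls n a ∈ F.grAddSubgroup I :=
  (F.cls_mem_grAddSubgroup_iff I n a).2 ⟨a, ha, by simp⟩

theorem grAddSubgroup_le_iff {I : AddSubgroup A} {J : AddSubgroup F.Gr} :
    F.grAddSubgroup I ≤ J ↔ ∀ n (a : F.toFun n), (a : A) ∈ I → F.cls n a ∈ J := by
  refine ⟨fun h n a ha => h (F.cls_mem_grAddSubgroup ha), fun h x hx => ?_⟩
  classical
  rw [show x = _ from (DirectSum.sum_support_of (β := F.GrPiece) x).symm]
  refine AddSubgroup.sum_mem (K := J) fun n _ => ?_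
  obtain ⟨a, ha, hax⟩ := hx n
  have hcls : F.cls n a = DirectSum.of F.GrPiece n (F.component n x) :=
    congrArg (DirectSum.of F.GrPiece n) hax
  exact hcls ▸ h n a ha

theorem mul_mem_grAddSubgroup_left {I : AddSubgroup A} (hI : ∀ a, ∀ b ∈ I, a * b ∈ I) (x : F.Gr)
    {y : F.Gr} (hy : y ∈ F.grAddSubgroup I) : x * y ∈ F.grAddSubgroup I := by
  suffices h : F.grAddSubgroup I ≤ (F.grAddSubgroup I).comap (AddMonoidHom.mulLeft x) from h hy
  refine F.grAddSubgroup_le_iff.2 fun n b hb => ?_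
  change x * F.cls n b ∈ F.grAddSubgroup I
  induction x using F.gr_induction with
  | zero => rw [zero_mul]; exact AddSubgroup.zero_mem _
  | add x y hx hy => rw [add_mul]; exact AddSubgroup.add_mem _ hx hy
  | cls m a => rw [cls_mul]; exact F.cls_mem_grAddSubgroup (hI _ _ hb)

theorem mul_mem_grAddSubgroup_right {I : AddSubgroup A} (hI : ∀ a, ∀ b ∈ I, b * a ∈ I) (x : F.Gr)
    {y : F.Gr} (hy : y ∈ F.grAddSubgroup I) : y * x ∈ F.grAddSubgroup I := by
  suffices h : F.grAddSubgroup I ≤ (F.grAddSubgroup I).comap (AddMonoidHom.mulRight x) from h hy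
  refine F.grAddSubgroup_le_iff.2 fun n b hb => ?_
  change F.cls n b * x ∈ F.grAddSubgroup I
  induction x using F.gr_induction with
  | zero => rw [mul_zero]; exact AddSubgroup.zero_mem _
  | add x y hx hy => rw [mul_add]; exact AddSubgroup.add_mem _ hx hy
  | cls m a => rw [cls_mul]; exact F.cls_mem_grAddSubgroup (hI _ _ hb)

theorem le_of_grAddSubgroup_le {I J : AddSubgroup A} (hIJ : I ≤ J)
    (hgr : F.grAddSubgroup J ≤ F.grAddSubgroup I) : J ≤ I := by
  have exists_sub_mem_pred : ∀ n, ∀ a ∈ F.toFun n, a ∈ J → ∃ b ∈ I, a - b ∈ F.pred n := by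
    intro n a ha haJ
    obtain ⟨b, hb, hab⟩ := (F.cls_mem_grAddSubgroup_iff I n ⟨a, ha⟩).1
      (hgr (F.cls_mem_grAddSubgroup haJ))
    exact ⟨b, hb, hab⟩
  have layer_inf_le : ∀ n, ∀ a ∈ F.toFun n, a ∈ J → a ∈ I := by
    intro n
    induction n with
    | zero =>
      intro a ha haJ
      obtain ⟨b, hb, hab⟩ := exists_sub_mem_pred 0 a ha haJ
      rwa [sub_eq_zero.1 ((Submodule.mem_bot R).1 hab)]
    | succ n ih =>
      intro a ha haJ
      obtain ⟨b, hb, hab⟩ := exists_sub_mem_pred (n + 1) a ha haJ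
      simpa only [sub_add_cancel] using I.add_mem (ih _ hab (J.sub_mem haJ (hIJ hb))) hb
  intro a ha
  obtain ⟨n, hn⟩ := F.exhaustive' a
  exact layer_inf_le n a hn ha

theorem grAddSubgroup_strictMono : StrictMono F.grAddSubgroup := fun _ _ hIJ =>
  lt_of_le_not_ge (F.grAddSubgroup_le_iff.2 fun _ _ ha => F.cls_mem_grAddSubgroup (hIJ.le ha))
    fun h => hIJ.not_ge (F.le_of_grAddSubgroup_le hIJ.le h)

theorem isNoetherianRing_of_gr (h : IsNoetherianRing F.Gr) : IsNoetherianRing A := by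
  rw [isNoetherianRing_iff, isNoetherian_iff'] at h ⊢
  let grIdeal : Ideal A → Ideal F.Gr := fun I =>
    { F.grAddSubgroup I.toAddSubgroup with
      smul_mem' := fun x _ hy =>
        F.mul_mem_grAddSubgroup_left (fun a _ hb => I.mul_mem_left a hb) x hy }
  refine StrictMono.wellFoundedGT (f := grIdeal) fun I J hIJ => ?_
  exact F.grAddSubgroup_strictMono (a := I.toAddSubgroup) (b := J.toAddSubgroup) hIJ

theorem isNoetherianRing_op_of_gr (h : IsNoetherianRing F.Grᵐᵒᵖ) : IsNoetherianRing Aᵐᵒᵖ := by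
  rw [isNoetherianRing_iff, isNoetherian_iff'] at h ⊢
  let unop : Ideal Aᵐᵒᵖ → AddSubgroup A := fun I =>
    I.toAddSubgroup.comap (MulOpposite.opAddEquiv : A ≃+ Aᵐᵒᵖ).toAddMonoidHom
  let grIdeal : Ideal Aᵐᵒᵖ → Ideal F.Grᵐᵒᵖ := fun I =>
    { (F.grAddSubgroup (unop I)).comap
        (MulOpposite.opAddEquiv : F.Gr ≃+ F.Grᵐᵒᵖ).symm.toAddMonoidHom with
      smul_mem' := fun x _ hy =>
        F.mul_mem_grAddSubgroup_right (I := unop I)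
          (fun a _ hb => I.mul_mem_left (MulOpposite.op a) hb) x.unop hy }
  refine StrictMono.wellFoundedGT (f := grIdeal) fun I J hIJ => ?_
  have hlt : unop I < unop J :=
    ⟨fun a ha => hIJ.1 ha, fun h => hIJ.2 fun a ha => h (x := a.unop) ha⟩
  have hgr := F.grAddSubgroup_strictMono hlt
  exact ⟨fun a ha => hgr.1 ha, fun h' => hgr.2 fun a ha => h' (x := MulOpposite.op a) ha⟩

theorem isNoethRing_of_gr (h : IsNoethRing F.Gr) : IsNoethRing A :=
  ⟨F.isNoetherianRing_of_gr h.left, F.isNoetherianRing_op_of_gr h.right⟩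

end Noetherian

end AlgFiltration

theorem IsNoethRing.of_surjective {A B : Type*} [Ring A] [Ring B] (f : A →+* B)
    (hf : Function.Surjective f) (h : IsNoethRing A) : IsNoethRing B where
  left :=
    have := h.left
    isNoetherianRing_of_surjective A B f hf
  right :=
    have := h.right
    isNoetherianRing_of_surjective Aᵐᵒᵖ Bᵐᵒᵖ f.op fun b => by
      obtain ⟨a, ha⟩ := hf b.unop
      exact ⟨MulOpposite.op a, congrArg MulOpposite.op ha⟩

/-! ### Algebras generated by two commuting factors -/

/-- `X` is spanned over `R` by the products `α₁ a * α₂ b`, and the images of `α₁` and `α₂` commute.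
This is the relation of `G₁ ⊗ G₂`, suitably base changed, to its two factors. The factors keep base
rings of their own because the two orders in the theorem live over different rings. -/
structure IsCommProduct (R : Type*) {S₁ S₂ G₁ G₂ X : Type*} [CommRing R] [CommRing S₁]
    [CommRing S₂] [Ring G₁] [Ring G₂] [Ring X] [Algebra S₁ G₁] [Algebra S₂ G₂] [Algebra R X]
    [Algebra S₁ X] [Algebra S₂ X] (α₁ : G₁ →ₐ[S₁] X) (α₂ : G₂ →ₐ[S₂] X) : Prop where
  commute : ∀ a b, Commute (α₁ a) (α₂ b)
  span_eq_top : Submodule.span R (Set.range fun p : G₁ × G₂ => α₁ p.1 * α₂ p.2) = ⊤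

section ExtendScalars

variable {K S G X : Type*} [CommRing K] [CommRing S] [Ring G] [Ring X] [Algebra S G] [Algebra S K]
  [Algebra K X] [Algebra S X] [IsScalarTower S K X]

variable (K) in
/-- The extension to `K ⊗ G` of a homomorphism from `G` to a `K`-algebra. -/
noncomputable def extendScalars (α : G →ₐ[S] X) : K ⊗[S] G →ₐ[K] X :=
  Algebra.TensorProduct.lift (Algebra.ofId K X) α fun c _ => by
    rw [Algebra.ofId_apply]
    exact Algebra.commute_algebraMap_left c _

theorem extendScalars_tmul (α : G →ₐ[S] X) (c : K) (g : G) :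
    extendScalars K α (c ⊗ₜ g) = c • α g := by
  rw [extendScalars, Algebra.TensorProduct.lift_tmul, Algebra.ofId_apply, Algebra.smul_def]

theorem extendScalars_one_tmul (α : G →ₐ[S] X) (g : G) :
    extendScalars K α (1 ⊗ₜ g) = α g := by
  rw [extendScalars_tmul, one_smul]

theorem commute_extendScalars {α : G →ₐ[S] X} {x : X} (h : ∀ g, Commute x (α g)) (t : K ⊗[S] G) :
    Commute x (extendScalars K α t) := by
  induction t using TensorProduct.induction_on with
  | zero => rw [map_zero]; exact Commute.zero_right x
  | add t u ht hu => rw [map_add]; exact ht.add_right hu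
  | tmul c g => rw [extendScalars_tmul]; exact (h g).smul_right c

end ExtendScalars

section MulMemSpan

variable {R S₁ S₂ G₁ G₂ X : Type*} [CommRing R] [CommRing S₁] [CommRing S₂] [Ring G₁] [Ring G₂]
  [Ring X] [Algebra S₁ G₁] [Algebra S₂ G₂] [Algebra R X] [Algebra S₁ X] [Algebra S₂ X]
  [Algebra S₁ R] [Algebra S₂ R] [IsScalarTower S₁ R X] [IsScalarTower S₂ R X]

variable (R) in
theorem mul_mem_span_image2 (α₁ : G₁ →ₐ[S₁] X) (α₂ : G₂ →ₐ[S₂] X) {s : Set G₁} {t : Set G₂}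
    {a : G₁} {b : G₂} (ha : a ∈ Submodule.span S₁ s) (hb : b ∈ Submodule.span S₂ t) :
    α₁ a * α₂ b ∈ Submodule.span R (Set.image2 (fun a b => α₁ a * α₂ b) s t) := by
  induction ha using Submodule.span_induction with
  | zero => simp
  | add x y _ _ hx hy => rw [map_add, add_mul]; exact Submodule.add_mem _ hx hy
  | smul r x _ hx =>
    rw [map_smul, smul_mul_assoc, ← algebraMap_smul R r]
    exact Submodule.smul_mem _ _ hx
  | mem x hx =>
    induction hb using Submodule.span_induction with
    | zero => simp
    | add y z _ _ hy hz => rw [map_add, mul_add]; exact Submodule.add_mem _ hy hz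
    | smul r y _ hy =>
      rw [map_smul, mul_smul_comm, ← algebraMap_smul R r]
      exact Submodule.smul_mem _ _ hy
    | mem y hy => exact Submodule.subset_span ⟨x, hx, y, hy, rfl⟩

end MulMemSpan

namespace IsCommProduct

section Basic

variable {R S₁ S₂ G₁ G₂ X : Type*} [CommRing R] [CommRing S₁] [CommRing S₂] [Ring G₁] [Ring G₂]
  [Ring X] [Algebra S₁ G₁] [Algebra S₂ G₂] [Algebra R X] [Algebra S₁ X] [Algebra S₂ X]
  {α₁ : G₁ →ₐ[S₁] X} {α₂ : G₂ →ₐ[S₂] X}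

theorem eq_top_of_mul_mem (h : IsCommProduct R α₁ α₂) {p : Submodule R X}
    (hp : ∀ a b, α₁ a * α₂ b ∈ p) : p = ⊤ := by
  rw [eq_top_iff, ← h.span_eq_top, Submodule.span_le]
  rintro _ ⟨⟨a, b⟩, rfl⟩
  exact hp a b

theorem extend {K₁ K₂ : Type*} [CommRing K₁] [CommRing K₂] [Algebra S₁ K₁]
    [Algebra S₂ K₂] [Algebra K₁ X] [Algebra K₂ X] [IsScalarTower S₁ K₁ X]
    [IsScalarTower S₂ K₂ X] (h : IsCommProduct R α₁ α₂) :
    IsCommProduct R (extendScalars K₁ α₁) (extendScalars K₂ α₂) where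
  commute a b := commute_extendScalars
    (fun g => (commute_extendScalars (fun g' => (h.commute g' g).symm) a).symm) b
  span_eq_top := h.eq_top_of_mul_mem fun a b => Submodule.subset_span
    ⟨(1 ⊗ₜ a, 1 ⊗ₜ b), congrArg₂ _ (extendScalars_one_tmul α₁ a) (extendScalars_one_tmul α₂ b)⟩

theorem span_image2_eq_top [Algebra S₁ R] [Algebra S₂ R] [IsScalarTower S₁ R X]
    [IsScalarTower S₂ R X] (h : IsCommProduct R α₁ α₂) {s : Set G₁} {t : Set G₂}
    (hs : Submodule.span S₁ s = ⊤) (ht : Submodule.span S₂ t = ⊤) :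
    Submodule.span R (Set.image2 (fun a b => α₁ a * α₂ b) s t) = ⊤ :=
  h.eq_top_of_mul_mem fun _ _ =>
    mul_mem_span_image2 R α₁ α₂ (hs ▸ Submodule.mem_top) (ht ▸ Submodule.mem_top)

theorem comp {C Z : Type*} [CommRing C] [Ring Z] [Algebra R C] [Algebra C Z] [Algebra R Z]
    [IsScalarTower R C Z] [Algebra S₁ R] [Algebra S₂ R] [IsScalarTower S₁ R X]
    [IsScalarTower S₂ R X] [Algebra S₁ Z] [Algebra S₂ Z] [IsScalarTower S₁ R Z]
    [IsScalarTower S₂ R Z] (h : IsCommProduct R α₁ α₂) (f : X →ₐ[R] Z)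
    (hf : Submodule.span C (Set.range f) = ⊤) :
    IsCommProduct C ((f.restrictScalars S₁).comp α₁) ((f.restrictScalars S₂).comp α₂) where
  commute a b := (h.commute a b).map f
  span_eq_top := by
    set P := Submodule.span C (Set.range fun p : G₁ × G₂ => f (α₁ p.1) * f (α₂ p.2))
    have hP : (P.restrictScalars R).comap f.toLinearMap = ⊤ := h.eq_top_of_mul_mem fun a b =>
      Submodule.subset_span ⟨(a, b), (map_mul f _ _).symm⟩
    rw [← top_le_iff, ← hf, Submodule.span_le]
    rintro _ ⟨x, rfl⟩
    exact hP.ge (Submodule.mem_top (x := x))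

theorem finiteType [Algebra S₁ R] [Algebra S₂ R] [IsScalarTower S₁ R X] [IsScalarTower S₂ R X]
    (h : IsCommProduct R α₁ α₂) (h₁ : Algebra.FiniteType S₁ G₁)
    (h₂ : Algebra.FiniteType S₂ G₂) : Algebra.FiniteType R X := by
  classical
  obtain ⟨s, hs⟩ := h₁.out
  obtain ⟨t, ht⟩ := h₂.out
  let U := Algebra.adjoin R (↑(s.image α₁ ∪ t.image α₂) : Set X)
  have hsU : (U.restrictScalars S₁).comap α₁ = ⊤ := by
    rw [← top_le_iff, ← hs]
    exact Algebra.adjoin_le fun x hx =>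
      Algebra.subset_adjoin (Finset.mem_union_left _ (Finset.mem_image_of_mem α₁ hx))
  have htU : (U.restrictScalars S₂).comap α₂ = ⊤ := by
    rw [← top_le_iff, ← ht]
    exact Algebra.adjoin_le fun x hx =>
      Algebra.subset_adjoin (Finset.mem_union_right _ (Finset.mem_image_of_mem α₂ hx))
  refine ⟨s.image α₁ ∪ t.image α₂, Algebra.toSubmodule_eq_top.1 (h.eq_top_of_mul_mem ?_)⟩
  exact fun a b => U.mul_mem (hsU.ge (Algebra.mem_top (x := a))) (htU.ge (Algebra.mem_top (x := b)))

end Basic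

section BaseChange

variable {R C S₁ S₂ G₁ G₂ X : Type*} [CommRing R] [CommRing C] [CommRing S₁] [CommRing S₂]
  [Ring G₁] [Ring G₂] [Ring X] [Algebra S₁ G₁] [Algebra S₂ G₂] [Algebra R X] [Algebra S₁ X]
  [Algebra S₂ X] [Algebra S₁ R] [Algebra S₂ R] [IsScalarTower S₁ R X] [IsScalarTower S₂ R X]
  [Algebra R C] [Algebra S₁ C] [Algebra S₂ C] [IsScalarTower S₁ R C] [IsScalarTower S₂ R C]
  {α₁ : G₁ →ₐ[S₁] X} {α₂ : G₂ →ₐ[S₂] X}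

theorem baseChange (h : IsCommProduct R α₁ α₂) :
    IsCommProduct C
      (((Algebra.TensorProduct.includeRight : X →ₐ[R] C ⊗[R] X).restrictScalars S₁).comp α₁)
      (((Algebra.TensorProduct.includeRight : X →ₐ[R] C ⊗[R] X).restrictScalars S₂).comp α₂) := by
  refine h.comp _ (eq_top_iff.2 fun t _ => ?_)
  induction t using TensorProduct.induction_on with
  | zero => exact Submodule.zero_mem _
  | add t u ht hu => exact Submodule.add_mem _ (ht trivial) (hu trivial)
  | tmul c x =>
    rw [← mul_one c, ← smul_eq_mul, ← TensorProduct.smul_tmul']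
    exact Submodule.smul_mem _ _ (Submodule.subset_span ⟨x, rfl⟩)

end BaseChange

section Noetherian

variable {R S₁ S₂ G₁ G₂ X : Type u} [CommRing R] [CommRing S₁] [CommRing S₂] [Ring G₁] [Ring G₂]
  [Ring X] [Algebra S₁ G₁] [Algebra S₂ G₂] [Algebra R X] [Algebra S₁ X] [Algebra S₂ X]
  [Algebra S₁ R] [Algebra S₂ R] [IsScalarTower S₁ R X] [IsScalarTower S₂ R X]
  {α₁ : G₁ →ₐ[S₁] X} {α₂ : G₂ →ₐ[S₂] X}

/-- `X` is a quotient of `G₁ ⊗ (R ⊗ G₂)`, whose second factor is noetherian but not commutative: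
this is where strong noetherianity of `G₁` would not suffice. -/
theorem isNoethRing (h : IsCommProduct R α₁ α₂) (hR : IsNoetherianRing R)
    (h₁ : IsUniversallyNoetherian S₁ G₁) (h₂ : IsStronglyNoetherian S₂ G₂) : IsNoethRing X := by
  have hRG₂ : IsNoethRing (R ⊗[S₂] G₂) :=
    (h₂ R hR).of_surjective (Algebra.TensorProduct.comm S₂ G₂ R).toAlgHom.toRingHom
      (Algebra.TensorProduct.comm S₂ G₂ R).surjective
  let β : R ⊗[S₂] G₂ →ₐ[R] X := extendScalars R α₂
  let φ : G₁ ⊗[S₁] (R ⊗[S₂] G₂) →ₐ[S₁] X :=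
    Algebra.TensorProduct.lift α₁ (β.restrictScalars S₁) fun a b =>
      commute_extendScalars (h.commute a) b
  have hφ : ∀ a b, φ (a ⊗ₜ b) = α₁ a * β b :=
    Algebra.TensorProduct.lift_tmul α₁ (β.restrictScalars S₁) _
  let range : Submodule R X :=
    { φ.range.toSubmodule.toAddSubmonoid with
      smul_mem' := by
        rintro r _ ⟨z, rfl⟩
        refine ⟨(1 ⊗ₜ (r ⊗ₜ 1)) * z, ?_⟩
        change φ _ = r • φ z
        rw [map_mul, hφ, map_one, one_mul, extendScalars_tmul, map_one, smul_one_mul] }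
  have hrange : range = ⊤ := h.eq_top_of_mul_mem fun a b =>
    ⟨a ⊗ₜ (1 ⊗ₜ b), (hφ _ _).trans (congrArg _ (extendScalars_one_tmul α₂ b))⟩
  exact (h₁ _ hRG₂).of_surjective φ.toRingHom fun x => hrange.ge (Submodule.mem_top (x := x))

theorem isStronglyNoetherian (h : IsCommProduct R α₁ α₂) (h₁ : IsUniversallyNoetherian S₁ G₁)
    (h₂ : IsStronglyNoetherian S₂ G₂) : IsStronglyNoetherian R X := by
  intro C _ _ hC
  let := Algebra.compHom C (algebraMap S₁ R)
  let := Algebra.compHom C (algebraMap S₂ R)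
  have : IsScalarTower S₁ R C := IsScalarTower.of_algebraMap_eq fun _ => rfl
  have : IsScalarTower S₂ R C := IsScalarTower.of_algebraMap_eq fun _ => rfl
  exact ((h.baseChange (C := C)).isNoethRing hC h₁ h₂).of_surjective
    (Algebra.TensorProduct.comm R C X).toAlgHom.toRingHom
    (Algebra.TensorProduct.comm R C X).surjective

end Noetherian

end IsCommProduct

section Order

variable {k D : Type*} [CommRing k] [CommRing D] [Algebra D k]

theorem isOrder_of_basis {X Y ι : Type*} [Ring X] [Algebra D X] [Ring Y] [Algebra k Y]
    [Algebra D Y] [IsScalarTower D k Y] (hDk : Function.Injective (algebraMap D k))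
    (f : X →ₐ[D] Y) {v : ι → X} (hv : ⊤ ≤ Submodule.span D (Set.range v))
    (c : Module.Basis ι k Y) (hc : ∀ i, f (v i) = c i) : IsOrder k f := by
  have hfv : f.toLinearMap ∘ v = c := funext hc
  have hcD : LinearIndependent D c := c.linearIndependent.restrict_scalars fun x y hxy =>
    hDk (by simpa only [Algebra.smul_def, mul_one] using hxy)
  let b : Module.Basis ι D X :=
    Module.Basis.mk (LinearIndependent.of_comp f.toLinearMap (hfv ▸ hcD)) hv
  have hf : f.toLinearMap = Finsupp.linearCombination D c ∘ₗ b.repr.toLinearMap :=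
    b.ext fun i => by
      rw [LinearMap.comp_apply, LinearEquiv.coe_coe, Module.Basis.repr_self,
        Finsupp.linearCombination_single, one_smul, ← hc, Module.Basis.mk_apply,
        AlgHom.toLinearMap_apply]
  exact
    { injective := by
        change Function.Injective f.toLinearMap
        rw [hf]
        exact (show Function.Injective (Finsupp.linearCombination D c) from hcD).comp
          b.repr.injective
      free := Module.Free.of_basis b
      baseChange := hf ▸ IsBaseChange.comp_equiv b.repr _ (IsBaseChange.of_basis D c) }

variable {D₁ D₂ V₁ V₂ W₁ W₂ X Y : Type*} [CommRing D₁] [CommRing D₂]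
  [Algebra D₁ k] [Algebra D₂ k] [Algebra D₁ D] [Algebra D₂ D]
  [Ring V₁] [Ring V₂] [Algebra D₁ V₁] [Algebra D₂ V₂]
  [Ring W₁] [Ring W₂] [Algebra k W₁] [Algebra k W₂] [Algebra D₁ W₁] [Algebra D₂ W₂]
  [IsScalarTower D₁ k W₁] [IsScalarTower D₂ k W₂]
  [Ring X] [Algebra D X] [Algebra D₁ X] [Algebra D₂ X] [IsScalarTower D₁ D X]
  [IsScalarTower D₂ D X] [Ring Y] [Algebra k Y] [Algebra D Y] [IsScalarTower D k Y]

theorem IsCommProduct.isOrder {α₁ : V₁ →ₐ[D₁] X} {α₂ : V₂ →ₐ[D₂] X} (h : IsCommProduct D α₁ α₂)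
    (hDk : Function.Injective (algebraMap D k)) {f₁ : V₁ →ₐ[D₁] W₁} {f₂ : V₂ →ₐ[D₂] W₂}
    (h₁ : IsOrder k f₁) (h₂ : IsOrder k f₂) (e : W₁ ⊗[k] W₂ ≃ₗ[k] Y) {f : X →ₐ[D] Y}
    (hf : ∀ v w, f (α₁ v * α₂ w) = e (f₁ v ⊗ₜ f₂ w)) : IsOrder k f := by
  have := h₁.free
  have := h₂.free
  let b₁ := Module.Free.chooseBasis D₁ V₁
  let b₂ := Module.Free.chooseBasis D₂ V₂
  refine isOrder_of_basis hDk f (v := fun p : _ × _ => α₁ (b₁ p.1) * α₂ (b₂ p.2)) ?_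
    (((h₁.baseChange.basis b₁).tensorProduct (h₂.baseChange.basis b₂)).map e) fun p => ?_
  · rw [← h.span_image2_eq_top b₁.span_eq b₂.span_eq]
    refine Submodule.span_mono ?_
    rintro _ ⟨_, ⟨i, rfl⟩, _, ⟨j, rfl⟩, rfl⟩
    exact ⟨(i, j), rfl⟩
  · rw [hf, Module.Basis.map_apply, Module.Basis.tensorProduct_apply, IsBaseChange.basis_apply,
      IsBaseChange.basis_apply]
    rfl

end Order

/-! ### Products of filtrations -/

namespace AlgFiltration

section Product

variable {R S₁ S₂ A₁ A₂ A : Type*} [CommRing R] [CommRing S₁] [CommRing S₂] [Ring A₁] [Ring A₂]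
  [Ring A] [Algebra S₁ A₁] [Algebra S₂ A₂] [Algebra R A] [Algebra S₁ A] [Algebra S₂ A]

section Layer

variable (R) (F₁ : AlgFiltration S₁ A₁) (F₂ : AlgFiltration S₂ A₂) (j₁ : A₁ →ₐ[S₁] A)
  (j₂ : A₂ →ₐ[S₂] A)

/-- The `n`-th layer of the product of two filtrations along homomorphisms `j₁` and `j₂` to a
common algebra; the scalars `R` need not be those of either filtration. -/
def productLayer (n : ℕ) : Submodule R A :=
  Submodule.span R
    {t | ∃ r s : ℕ, r + s ≤ n ∧ ∃ a ∈ F₁.toFun r, ∃ b ∈ F₂.toFun s, j₁ a * j₂ b = t}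

theorem monotone_productLayer : Monotone (productLayer R F₁ F₂ j₁ j₂) := by
  intro m n hmn
  refine Submodule.span_mono ?_
  rintro t ⟨r, s, hrs, h⟩
  exact ⟨r, s, hrs.trans hmn, h⟩

variable {F₁ F₂ j₁ j₂}

theorem mul_mem_productLayer {r s n : ℕ} (hrs : r + s ≤ n) {a : A₁} {b : A₂}
    (ha : a ∈ F₁.toFun r) (hb : b ∈ F₂.toFun s) : j₁ a * j₂ b ∈ productLayer R F₁ F₂ j₁ j₂ n :=
  Submodule.subset_span ⟨r, s, hrs, a, ha, b, hb, rfl⟩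

variable {R}

theorem productLayer_mul_mem (hc : ∀ a b, Commute (j₁ a) (j₂ b)) {i j : ℕ} {x y : A}
    (hx : x ∈ productLayer R F₁ F₂ j₁ j₂ i) (hy : y ∈ productLayer R F₁ F₂ j₁ j₂ j) :
    x * y ∈ productLayer R F₁ F₂ j₁ j₂ (i + j) := by
  have hxy := Submodule.mul_mem_mul hx hy
  rw [productLayer, productLayer, Submodule.span_mul_span] at hxy
  refine Submodule.span_mono ?_ hxy
  rintro _ ⟨_, ⟨r, s, hrs, a, ha, b, hb, rfl⟩, _, ⟨r', s', hrs', a', ha', b', hb', rfl⟩, rfl⟩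
  refine ⟨r + r', s + s', by omega, a * a', F₁.mul_mem' ha ha', b * b', F₂.mul_mem' hb hb', ?_⟩
  rw [map_mul, map_mul]
  exact ((hc a' b).symm.mul_mul_mul_comm _ _).symm

theorem exists_mem_productLayer (h : IsCommProduct R j₁ j₂) (x : A) :
    ∃ n, x ∈ productLayer R F₁ F₂ j₁ j₂ n := by
  rw [← Submodule.mem_iSup_of_directed _ (monotone_productLayer R F₁ F₂ j₁ j₂).directed_le]
  refine (h.eq_top_of_mul_mem fun a b => ?_).ge (Submodule.mem_top (x := x))
  obtain ⟨r, hr⟩ := F₁.exhaustive' a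
  obtain ⟨s, hs⟩ := F₂.exhaustive' b
  exact Submodule.mem_iSup_of_mem (r + s) (mul_mem_productLayer R (F₁ := F₁) le_rfl hr hs)

variable (F₁ F₂) in
/-- The product of two filtrations on the algebra spanned by the products of elements of the two
filtered algebras. -/
def product (h : IsCommProduct R j₁ j₂) : AlgFiltration R A where
  toFun := productLayer R F₁ F₂ j₁ j₂
  mono' := monotone_productLayer R F₁ F₂ j₁ j₂
  one_mem' := by
    simpa only [map_one, mul_one] using
      mul_mem_productLayer R (j₁ := j₁) (j₂ := j₂) (add_zero 0).le F₁.one_mem' F₂.one_mem'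
  mul_mem' := productLayer_mul_mem h.commute
  exhaustive' := exists_mem_productLayer h

end Layer

/-- `F` is the product of the filtrations `F₁` and `F₂` along `j₁` and `j₂`. As a predicate this
also applies to filtrations constructed in another way, such as induced ones. -/
def IsProduct (F₁ : AlgFiltration S₁ A₁) (F₂ : AlgFiltration S₂ A₂) (F : AlgFiltration R A)
    (j₁ : A₁ →ₐ[S₁] A) (j₂ : A₂ →ₐ[S₂] A) : Prop :=
  ∀ n, F.toFun n = productLayer R F₁ F₂ j₁ j₂ n

variable {F₁ : AlgFiltration S₁ A₁} {F₂ : AlgFiltration S₂ A₂} {F : AlgFiltration R A}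
  {j₁ : A₁ →ₐ[S₁] A} {j₂ : A₂ →ₐ[S₂] A}

theorem isProduct_product (h : IsCommProduct R j₁ j₂) :
    IsProduct F₁ F₂ (product F₁ F₂ h) j₁ j₂ :=
  fun _ => rfl

namespace IsProduct

theorem mul_mem (h : IsProduct F₁ F₂ F j₁ j₂) {r s n : ℕ} (hrs : r + s ≤ n) {a : A₁} {b : A₂}
    (ha : a ∈ F₁.toFun r) (hb : b ∈ F₂.toFun s) : j₁ a * j₂ b ∈ F.toFun n := by
  rw [h n]
  exact mul_mem_productLayer R hrs ha hb

theorem layer_le (h : IsProduct F₁ F₂ F j₁ j₂) {n : ℕ} {p : Submodule R A}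
    (hp : ∀ r s, r + s ≤ n → ∀ a ∈ F₁.toFun r, ∀ b ∈ F₂.toFun s, j₁ a * j₂ b ∈ p) :
    F.toFun n ≤ p := by
  rw [h n, productLayer, Submodule.span_le]
  rintro _ ⟨r, s, hrs, a, ha, b, hb, rfl⟩
  exact hp r s hrs a ha b hb

theorem isFilteredHom_left (h : IsProduct F₁ F₂ F j₁ j₂) : F₁.IsFilteredHom F j₁ :=
  fun n a ha => by simpa only [map_one, mul_one] using h.mul_mem (add_zero n).le ha F₂.one_mem'

theorem isFilteredHom_right (h : IsProduct F₁ F₂ F j₁ j₂) : F₂.IsFilteredHom F j₂ :=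
  fun n b hb => by simpa only [map_one, one_mul] using h.mul_mem (zero_add n).le F₁.one_mem' hb

variable [Algebra S₁ R] [Algebra S₂ R] [IsScalarTower S₁ R A] [IsScalarTower S₂ R A]

theorem commute_grMap (h : IsProduct F₁ F₂ F j₁ j₂) (hc : ∀ a b, Commute (j₁ a) (j₂ b))
    (x : F₁.Gr) (y : F₂.Gr) :
    Commute (h.isFilteredHom_left.grMap x) (h.isFilteredHom_right.grMap y) := by
  induction x using F₁.gr_induction with
  | zero => rw [map_zero]; exact Commute.zero_left _
  | add x x' hx hx' => rw [map_add]; exact hx.add_left hx'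
  | cls m a =>
    induction y using F₂.gr_induction with
    | zero => rw [map_zero]; exact Commute.zero_right _
    | add y y' hy hy' => rw [map_add]; exact hy.add_right hy'
    | cls n b =>
      rw [IsFilteredHom.grMap_cls, IsFilteredHom.grMap_cls, Commute, SemiconjBy, cls_mul, cls_mul]
      exact F.cls_congr (add_comm m n) (hc a b)

theorem cls_mem_of_mul_mem (h : IsProduct F₁ F₂ F j₁ j₂) {p : Submodule R F.Gr}
    (hp : ∀ x y, h.isFilteredHom_left.grMap x * h.isFilteredHom_right.grMap y ∈ p) (n : ℕ)
    (c : F.toFun n) : F.cls n c ∈ p := by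
  suffices hle : F.toFun n ≤ (p.comap (F.cls n)).map (F.toFun n).subtype by
    obtain ⟨c', hc', hcc'⟩ := hle c.2
    rwa [← Subtype.ext hcc']
  refine h.layer_le fun r s hrs a ha b hb => ⟨⟨_, h.mul_mem hrs ha hb⟩, ?_, rfl⟩
  change F.cls n _ ∈ p
  rcases hrs.lt_or_eq with hlt | rfl
  · rw [F.cls_eq_zero_iff.2 (F.toFun_le_pred hlt (h.mul_mem le_rfl ha hb))]
    exact Submodule.zero_mem p
  · have hmem := hp (F₁.cls r ⟨a, ha⟩) (F₂.cls s ⟨b, hb⟩)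
    rwa [IsFilteredHom.grMap_cls, IsFilteredHom.grMap_cls, cls_mul] at hmem

theorem gr (h : IsProduct F₁ F₂ F j₁ j₂) (hc : ∀ a b, Commute (j₁ a) (j₂ b)) :
    IsCommProduct R h.isFilteredHom_left.grMap h.isFilteredHom_right.grMap where
  commute := h.commute_grMap hc
  span_eq_top := by
    rw [eq_top_iff]
    rintro x -
    induction x using F.gr_induction with
    | zero => exact Submodule.zero_mem _
    | add x y hx hy => exact Submodule.add_mem _ hx hy
    | cls n c =>
      exact h.cls_mem_of_mul_mem (fun x y => Submodule.subset_span (Set.mem_range_self (x, y))) n c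

theorem locallyFinite (h : IsProduct F₁ F₂ F j₁ j₂) (h₁ : F₁.LocallyFinite)
    (h₂ : F₂.LocallyFinite) : F.LocallyFinite := by
  intro n
  choose s hs hs' using fun r => Submodule.fg_def.1 (Module.Finite.iff_fg.1 (h₁ r))
  choose t ht ht' using fun r => Submodule.fg_def.1 (Module.Finite.iff_fg.1 (h₂ r))
  let products (p : ℕ × ℕ) : Set A := Set.image2 (fun a b => j₁ a * j₂ b) (s p.1) (t p.2)
  rw [Module.Finite.iff_fg, Submodule.fg_def]
  refine ⟨⋃ p ∈ Finset.HasAntidiagonal.antidiagonal n, products p, ?_, le_antisymm ?_ ?_⟩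
  · exact Set.Finite.biUnion (Finset.finite_toSet _) fun p _ => (hs _).image2 _ (ht _)
  · refine Submodule.span_le.2 (Set.iUnion₂_subset fun p hp => ?_)
    rintro _ ⟨a, ha, b, hb, rfl⟩
    exact h.mul_mem (Finset.HasAntidiagonal.mem_antidiagonal.1 hp).le
      (hs' p.1 ▸ Submodule.subset_span ha) (ht' p.2 ▸ Submodule.subset_span hb)
  · refine h.layer_le fun r q hrq a ha b hb => ?_
    have hp : (n - q, q) ∈ Finset.HasAntidiagonal.antidiagonal n :=
      Finset.HasAntidiagonal.mem_antidiagonal.2 (by omega)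
    have ha' : a ∈ F₁.toFun (n - q) := F₁.mono' (by omega) ha
    rw [← hs'] at ha'
    rw [← ht'] at hb
    exact Submodule.span_mono (Set.subset_biUnion_of_mem (u := products) hp)
      (mul_mem_span_image2 R j₁ j₂ ha' hb)

end IsProduct

end Product

section TensorGr

variable {k A A₁ A₂ : Type*} [Field k] [Ring A] [Ring A₁] [Ring A₂] [Algebra k A] [Algebra k A₁]
  [Algebra k A₂]

section Symbol

variable (F : AlgFiltration k A) (F₁ : AlgFiltration k A₁) (F₂ : AlgFiltration k A₂)

/-- A linear extension to all of `A` of the principal symbol of degree `n`. It depends on the choice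
of a complement of the `n`-th layer, which exists because the scalars form a field. -/
noncomputable def extendCls (n : ℕ) : A →ₗ[k] F.Gr :=
  (F.cls n).comp
    (LinearMap.exists_leftInverse_of_injective (F.toFun n).subtype (Submodule.ker_subtype _)).choose

theorem extendCls_of_mem {n : ℕ} {a : A} (ha : a ∈ F.toFun n) : F.extendCls n a = F.cls n ⟨a, ha⟩ :=
  congrArg (F.cls n) (LinearMap.congr_fun (LinearMap.exists_leftInverse_of_injective
    (F.toFun n).subtype (Submodule.ker_subtype _)).choose_spec ⟨a, ha⟩)

theorem extendCls_of_mem_of_lt {m n : ℕ} (hmn : m < n) {a : A} (ha : a ∈ F.toFun m) :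
    F.extendCls n a = 0 := by
  rw [extendCls_of_mem F (F.mono' hmn.le ha), cls_eq_zero_iff]
  exact F.toFun_le_pred hmn ha

/-- On the `n`-th layer of the tensor-sum filtration of `A₁ ⊗ A₂` this is the principal symbol of
degree `n`, with values in `gr A₁ ⊗ gr A₂`. -/
noncomputable def tensorSymbol (n : ℕ) : A₁ ⊗[k] A₂ →ₗ[k] F₁.Gr ⊗[k] F₂.Gr :=
  ∑ p ∈ Finset.HasAntidiagonal.antidiagonal n,
    TensorProduct.map (F₁.extendCls p.1) (F₂.extendCls p.2)

theorem tensorSymbol_tmul (n : ℕ) (a : A₁) (b : A₂) :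
    F₁.tensorSymbol F₂ n (a ⊗ₜ b) =
      ∑ p ∈ Finset.HasAntidiagonal.antidiagonal n, F₁.extendCls p.1 a ⊗ₜ[k] F₂.extendCls p.2 b := by
  simp only [tensorSymbol, LinearMap.sum_apply, TensorProduct.map_tmul]

variable {F₁ F₂} {r s : ℕ} {a : A₁} {b : A₂}

theorem extendCls_tmul_extendCls_eq_zero (ha : a ∈ F₁.toFun r) (hb : b ∈ F₂.toFun s)
    {p : ℕ × ℕ} (hp : r < p.1 ∨ s < p.2) :
    F₁.extendCls p.1 a ⊗ₜ[k] F₂.extendCls p.2 b = 0 := by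
  rcases hp with hr | hs
  · rw [F₁.extendCls_of_mem_of_lt hr ha, TensorProduct.zero_tmul]
  · rw [F₂.extendCls_of_mem_of_lt hs hb, TensorProduct.tmul_zero]

theorem tensorSymbol_tmul_of_lt (ha : a ∈ F₁.toFun r) (hb : b ∈ F₂.toFun s) {n : ℕ}
    (hn : r + s < n) : F₁.tensorSymbol F₂ n (a ⊗ₜ b) = 0 := by
  rw [tensorSymbol_tmul]
  refine Finset.sum_eq_zero fun p hp => extendCls_tmul_extendCls_eq_zero ha hb ?_
  have := Finset.HasAntidiagonal.mem_antidiagonal.1 hp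
  omega

theorem tensorSymbol_tmul_of_mem (ha : a ∈ F₁.toFun r) (hb : b ∈ F₂.toFun s) :
    F₁.tensorSymbol F₂ (r + s) (a ⊗ₜ b) = F₁.cls r ⟨a, ha⟩ ⊗ₜ[k] F₂.cls s ⟨b, hb⟩ := by
  rw [tensorSymbol_tmul, ← F₁.extendCls_of_mem ha, ← F₂.extendCls_of_mem hb]
  refine Finset.sum_eq_single_of_mem (r, s) (Finset.HasAntidiagonal.mem_antidiagonal.2 rfl)
    fun p hp hne => ?_
  have hsum := Finset.HasAntidiagonal.mem_antidiagonal.1 hp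
  have hne' : ¬(p.1 = r ∧ p.2 = s) := fun h => hne (Prod.ext h.1 h.2)
  exact extendCls_tmul_extendCls_eq_zero ha hb (by omega)

end Symbol

namespace IsProduct

variable {F₁ : AlgFiltration k A₁} {F₂ : AlgFiltration k A₂} {F : AlgFiltration k A}
  {j₁ : A₁ →ₐ[k] A} {j₂ : A₂ →ₐ[k] A}

/-- Multiplication as a homomorphism `gr A₁ ⊗ gr A₂ → gr A`. -/
noncomputable def grTensorMap (h : IsProduct F₁ F₂ F j₁ j₂) (hc : ∀ a b, Commute (j₁ a) (j₂ b)) :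
    F₁.Gr ⊗[k] F₂.Gr →ₐ[k] F.Gr :=
  Algebra.TensorProduct.lift h.isFilteredHom_left.grMap h.isFilteredHom_right.grMap
    (h.commute_grMap hc)

variable (h : IsProduct F₁ F₂ F j₁ j₂) (hc : ∀ a b, Commute (j₁ a) (j₂ b))
include h hc

theorem grTensorMap_tmul (x : F₁.Gr) (y : F₂.Gr) :
    h.grTensorMap hc (x ⊗ₜ y) = h.isFilteredHom_left.grMap x * h.isFilteredHom_right.grMap y :=
  Algebra.TensorProduct.lift_tmul _ _ _ x y

theorem grTensorMap_cls_tmul_cls {m n : ℕ} (a : F₁.toFun m) (b : F₂.toFun n) :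
    h.grTensorMap hc (F₁.cls m a ⊗ₜ F₂.cls n b) =
      F.cls (m + n) ⟨j₁ a * j₂ b, h.mul_mem le_rfl a.2 b.2⟩ := by
  rw [grTensorMap_tmul, IsFilteredHom.grMap_cls, IsFilteredHom.grMap_cls, cls_mul]

theorem grTensorMap_surjective : Function.Surjective (h.grTensorMap hc) :=
  LinearMap.range_eq_top.1
    ((h.gr hc).eq_top_of_mul_mem fun x y => ⟨x ⊗ₜ y, h.grTensorMap_tmul hc x y⟩)

variable (e : A₁ ⊗[k] A₂ ≃ₗ[k] A) (he : ∀ a b, e (a ⊗ₜ b) = j₁ a * j₂ b)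
include he

omit hc in
theorem tensorSymbol_symm_eq_zero {n : ℕ} {x : A} (hx : x ∈ F.pred n) :
    F₁.tensorSymbol F₂ n (e.symm x) = 0 := by
  cases n with
  | zero => rw [(Submodule.mem_bot k).1 hx, map_zero, map_zero]
  | succ n =>
    suffices hle : F.toFun n ≤
        LinearMap.ker ((F₁.tensorSymbol F₂ (n + 1)).comp e.symm.toLinearMap) from hle hx
    refine h.layer_le fun r s hrs a ha b hb => ?_
    change F₁.tensorSymbol F₂ (n + 1) (e.symm (j₁ a * j₂ b)) = 0
    rw [← he, e.symm_apply_apply, tensorSymbol_tmul_of_lt ha hb (Nat.lt_succ_of_le hrs)]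

theorem grTensorMap_injective : Function.Injective (h.grTensorMap hc) := by
  let inverse : F.Gr →ₗ[k] F₁.Gr ⊗[k] F₂.Gr :=
    F.grDesc (fun n => ((F₁.tensorSymbol F₂ n).comp e.symm.toLinearMap).domRestrict (F.toFun n))
      fun _ _ hx => h.tensorSymbol_symm_eq_zero e he hx
  have hinverse : ∀ x, inverse (h.grTensorMap hc x) = x := by
    intro x
    induction x using TensorProduct.induction_on with
    | zero => rw [map_zero, map_zero]
    | add x y hx hy => rw [map_add, map_add, hx, hy]
    | tmul x y =>
      induction x using F₁.gr_induction with
      | zero => rw [TensorProduct.zero_tmul, map_zero, map_zero]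
      | add x x' hx hx' => rw [TensorProduct.add_tmul, map_add, map_add, hx, hx']
      | cls m a =>
        induction y using F₂.gr_induction with
        | zero => rw [TensorProduct.tmul_zero, map_zero, map_zero]
        | add y y' hy hy' => rw [TensorProduct.tmul_add, map_add, map_add, hy, hy']
        | cls n b =>
          rw [grTensorMap_cls_tmul_cls]
          refine (F.grDesc_cls _ _ _ _).trans ?_
          change F₁.tensorSymbol F₂ (m + n) (e.symm (j₁ a * j₂ b)) = _
          rw [← he, e.symm_apply_apply, tensorSymbol_tmul_of_mem a.2 b.2]
  exact Function.LeftInverse.injective hinverse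

/-- If multiplication is an isomorphism `A₁ ⊗ A₂ ≃ A`, then it is one on associated graded
algebras. -/
noncomputable def grTensorEquiv : F₁.Gr ⊗[k] F₂.Gr ≃ₗ[k] F.Gr :=
  LinearEquiv.ofBijective (h.grTensorMap hc).toLinearMap
    ⟨h.grTensorMap_injective hc e he, h.grTensorMap_surjective hc⟩

end IsProduct

end TensorGr

end AlgFiltration

/-! ### Multilinear identities and Regev's theorem -/

section MultilinearIdentities

theorem sum_superset_neg_one_pow_card {ι : Type*} [Fintype ι] [DecidableEq ι] (s : Finset ι) :
    ∑ T : Finset ι, (if s ⊆ T then (-1 : ℤ) ^ T.card else 0) =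
      if s = Finset.univ then (-1) ^ Fintype.card ι else 0 := by
  have hcompl (T : Finset ι) :
      (∏ t ∈ Finset.univ \ T, if t ∈ s then (0 : ℤ) else 1) = if s ⊆ T then 1 else 0 := by
    split_ifs with hT
    · refine Finset.prod_eq_one fun t ht => if_neg fun hts => ?_
      exact (Finset.mem_sdiff.1 ht).2 (hT hts)
    · obtain ⟨t, hts, htT⟩ := Finset.not_subset.1 hT
      exact Finset.prod_eq_zero (Finset.mem_sdiff.2 ⟨Finset.mem_univ t, htT⟩) (if_pos hts)
  have hprod := Finset.prod_add (fun _ => (-1 : ℤ)) (fun t => if t ∈ s then 0 else 1)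
    (Finset.univ : Finset ι)
  simp only [hcompl, Finset.prod_const, Finset.powerset_univ, mul_ite, mul_one, mul_zero] at hprod
  rw [← hprod]
  split_ifs with hs
  · simp [hs, Finset.card_univ]
  · obtain ⟨t, ht⟩ : ∃ t, t ∉ s := by simpa [Finset.eq_univ_iff_forall] using hs
    exact Finset.prod_eq_zero (Finset.mem_univ t) (by simp [ht])

theorem sum_neg_one_pow_card_smul_map_sum {κ ι M N : Type*} [Fintype κ] [Fintype ι]
    [DecidableEq κ] [DecidableEq ι] [AddCommGroup M] [AddCommGroup N]
    (f : MultilinearMap ℤ (fun _ : κ => M) N) (y : κ → ι → M) :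
    ∑ T : Finset ι, (-1 : ℤ) ^ T.card • f (fun s => ∑ t ∈ T, y s t) =
      (-1 : ℤ) ^ Fintype.card ι •
        ∑ r : κ → ι with Function.Surjective r, f (fun s => y s (r s)) := by
  have hexpand (T : Finset ι) : f (fun s => ∑ t ∈ T, y s t) =
      ∑ r : κ → ι, if Finset.univ.image r ⊆ T then f (fun s => y s (r s)) else 0 := by
    rw [f.map_sum_finset, ← Finset.sum_filter]
    refine Finset.sum_congr ?_ fun _ _ => rfl
    ext r
    simp [Fintype.mem_piFinset, Finset.image_subset_iff]
  simp_rw [hexpand, Finset.smul_sum]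
  rw [Finset.sum_comm, Finset.sum_filter]
  refine Finset.sum_congr rfl fun r _ => ?_
  have hsmul (T : Finset ι) : (-1 : ℤ) ^ T.card •
      (if Finset.univ.image r ⊆ T then f (fun s => y s (r s)) else 0) =
      (if Finset.univ.image r ⊆ T then (-1 : ℤ) ^ T.card else 0) • f (fun s => y s (r s)) := by
    rw [smul_ite, ite_smul, smul_zero, zero_smul]
  have hsurj : Finset.univ.image r = Finset.univ ↔ Function.Surjective r := by
    simp [Finset.eq_univ_iff_forall, Function.Surjective]
  simp_rw [hsmul]
  rw [← Finset.sum_smul, sum_superset_neg_one_pow_card, ite_smul, zero_smul]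
  exact if_congr hsurj rfl rfl

theorem sum_surjective_eq_sum_perm {ι M : Type*} [Fintype ι] [DecidableEq ι] [AddCommMonoid M]
    (g : (ι → ι) → M) :
    ∑ r : ι → ι with Function.Surjective r, g r = ∑ σ : Equiv.Perm ι, g σ := by
  symm
  refine Finset.sum_bij (fun σ _ => ⇑σ) (fun σ _ => by simpa using σ.surjective)
    (fun _ _ _ _ h => DFunLike.coe_injective h) (fun r hr => ?_) fun _ _ => rfl
  have hr' : Function.Surjective r := (Finset.mem_filter.1 hr).2
  exact ⟨Equiv.ofBijective r ⟨Finite.injective_iff_surjective.2 hr', hr'⟩, Finset.mem_univ _, rfl⟩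

theorem basisFreeMonoid_apply {K X : Type*} [CommRing K] (w : FreeMonoid X) :
    FreeAlgebra.basisFreeMonoid K X w = (w.toList.map (FreeAlgebra.ι K)).prod := by
  have hsingle : FreeAlgebra.basisFreeMonoid K X w =
      FreeAlgebra.equivMonoidAlgebraFreeMonoid.symm (MonoidAlgebra.single w 1) := by
    simp [FreeAlgebra.basisFreeMonoid]
  rw [hsingle, AlgEquiv.symm_apply_eq, map_list_prod, List.map_map]
  clear hsingle
  induction w using FreeMonoid.inductionOn' with
  | one => rfl
  | of_mul i w ih =>
    rw [FreeMonoid.toList_of_mul, List.map_cons, List.prod_cons, ← ih]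
    simp [FreeAlgebra.equivMonoidAlgebraFreeMonoid, MonoidAlgebra.single_mul_single]

theorem freeAlgebra_lift_eq_sum {K X A : Type*} [CommRing K] [Ring A] [Algebra K A]
    (f : FreeAlgebra K X) (x : X → A) :
    FreeAlgebra.lift K x f =
      ((FreeAlgebra.basisFreeMonoid K X).repr f).sum fun w c => c • (w.toList.map x).prod := by
  conv_lhs => rw [← (FreeAlgebra.basisFreeMonoid K X).linearCombination_repr f]
  rw [Finsupp.linearCombination_apply, Finsupp.sum, map_sum]
  refine Finset.sum_congr rfl fun w _ => ?_
  rw [map_smul, basisFreeMonoid_apply, map_list_prod, List.map_map]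
  congr 3
  exact funext fun i => FreeAlgebra.lift_ι_apply x i

/-- The family `α` of coefficients is a multilinear identity of degree `n` for the values of `j`:
the polynomial `∑ σ, α σ • X_{σ 0} ⋯ X_{σ (n - 1)}` vanishes whenever elements of the image of `j`
are substituted for its variables. An identity of the whole algebra is the case of the identity
homomorphism `j`. -/
def IsMultilinearIdentityOn {K M A : Type*} [CommRing K] [Monoid M] [Ring A] [Algebra K A] {n : ℕ}
    (j : M →* A) (α : Equiv.Perm (Fin n) → K) : Prop :=
  ∀ z : Fin n → M, ∑ σ, α σ • j (List.ofFn fun i => z (σ i)).prod = 0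

/-- Substituting `∑ t ∈ T with u t = j, z t` for the `j`-th variable and summing over `T` with
signs replaces a word by its multilinear part. -/
theorem sum_neg_one_pow_card_smul_prod_map {A X : Type*} [Ring A] [DecidableEq X] {d : ℕ}
    (u : Fin d → X) (z : Fin d → A) {l : List X} (hl : l.length ≤ d) :
    ∑ T : Finset (Fin d), (-1 : ℤ) ^ T.card •
        (l.map fun j => ∑ t ∈ T, if u t = j then z t else 0).prod =
      (-1 : ℤ) ^ d • ∑ σ : Equiv.Perm (Fin d),
        if (List.ofFn fun i => u (σ i)) = l then (List.ofFn fun i => z (σ i)).prod else 0 := by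
  obtain ⟨m, v, rfl⟩ : ∃ (m : ℕ) (v : Fin m → X), l = List.ofFn v :=
    ⟨_, _, (List.ofFn_get l).symm⟩
  rw [List.length_ofFn] at hl
  have hsum := sum_neg_one_pow_card_smul_map_sum (MultilinearMap.mkPiAlgebraFin ℤ m A)
    fun s t => if u t = v s then z t else 0
  simp only [MultilinearMap.mkPiAlgebraFin_apply, Fintype.card_fin] at hsum
  simp only [List.map_ofFn, Function.comp_def, hsum]
  congr 1
  rcases hl.lt_or_eq with hlt | rfl
  · have hnsurj (r : Fin m → Fin d) : ¬ Function.Surjective r := fun hr =>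
      hlt.not_ge (by simpa using Fintype.card_le_of_surjective r hr)
    have hne (σ : Equiv.Perm (Fin d)) : (List.ofFn fun i => u (σ i)) ≠ List.ofFn v := fun h =>
      hlt.ne' (by simpa using congrArg List.length h)
    simp [hnsurj, hne]
  · rw [sum_surjective_eq_sum_perm]
    refine Finset.sum_congr rfl fun σ _ => ?_
    split_ifs with hσ
    · have hσ' (s : Fin m) : u (σ s) = v s := congrFun (List.ofFn_injective hσ) s
      simp only [hσ', if_true]
    · obtain ⟨s, hs⟩ : ∃ s, u (σ s) ≠ v s := by
        by_contra! h
        exact hσ (congrArg List.ofFn (funext h))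
      exact List.prod_eq_zero ((List.mem_ofFn' _ _).2 ⟨s, if_neg hs⟩)

theorem IsPIAlgebra.exists_isMultilinearIdentityOn {K A : Type*} [Field K] [Ring A] [Algebra K A]
    (h : IsPIAlgebra K A) :
    ∃ (d : ℕ) (α : Equiv.Perm (Fin d) → K),
      α 1 ≠ 0 ∧ IsMultilinearIdentityOn (MonoidHom.id A) α := by
  let _ : DecidableEq (FreeMonoid ℕ) := inferInstanceAs (DecidableEq (List ℕ))
  obtain ⟨f, hf, hid⟩ := h
  set c := (FreeAlgebra.basisFreeMonoid K ℕ).repr f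
  have hc : c ≠ 0 := (map_ne_zero_iff _ (LinearEquiv.injective _)).2 hf
  obtain ⟨w₀, hw₀, hmax⟩ := Finset.exists_max_image c.support (fun w => w.toList.length)
    (Finsupp.support_nonempty_iff.2 hc)
  set d := w₀.toList.length
  let u : Fin d → ℕ := w₀.toList.get
  let word (σ : Equiv.Perm (Fin d)) : FreeMonoid ℕ := FreeMonoid.ofList (List.ofFn (u ∘ σ))
  have hword : word 1 = w₀ := congrArg FreeMonoid.ofList (List.ofFn_get w₀.toList)
  refine ⟨d, fun σ => c (word σ), ?_, fun z => ?_⟩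
  · simpa only [hword] using Finsupp.mem_support_iff.1 hw₀
  · have hcoeff (σ : Equiv.Perm (Fin d)) (p : A) :
        (∑ w ∈ c.support, c w • if word σ = w then p else 0) = c (word σ) • p := by
      simp only [smul_ite, smul_zero, Finset.sum_ite_eq]
      exact ite_eq_left_iff.2 fun h => by rw [Finsupp.notMem_support_iff.1 h, zero_smul]
    refine ((isUnit_neg_one (α := ℤ)).pow d).smul_eq_zero.1 ?_
    calc (-1 : ℤ) ^ d • ∑ σ, c (word σ) • (List.ofFn fun i => z (σ i)).prod
      _ = ∑ w ∈ c.support, c w • (-1 : ℤ) ^ d • ∑ σ : Equiv.Perm (Fin d),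
            if word σ = w then (List.ofFn fun i => z (σ i)).prod else 0 := by
        simp_rw [smul_comm (c _), ← Finset.smul_sum, Finset.smul_sum (r := c _)]
        rw [Finset.sum_comm]
        simp_rw [hcoeff]
      _ = ∑ w ∈ c.support, c w • ∑ T : Finset (Fin d), (-1 : ℤ) ^ T.card •
            (w.toList.map fun j => ∑ t ∈ T, if u t = j then z t else 0).prod :=
        Finset.sum_congr rfl fun w hw =>
          congrArg _ (sum_neg_one_pow_card_smul_prod_map u z (hmax w hw)).symm
      _ = ∑ T : Finset (Fin d), (-1 : ℤ) ^ T.card •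
            FreeAlgebra.lift K (fun j => ∑ t ∈ T, if u t = j then z t else 0) f := by
        simp_rw [freeAlgebra_lift_eq_sum, Finsupp.sum, Finset.smul_sum, smul_comm (_ : ℤ) (_ : K)]
        exact Finset.sum_comm
      _ = 0 := Finset.sum_eq_zero fun T _ => by rw [hid, smul_zero]

theorem IsMultilinearIdentityOn.isPIAlgebra {K A : Type*} [Field K] [Ring A] [Algebra K A]
    {n : ℕ} {α : Equiv.Perm (Fin n) → K} (h : IsMultilinearIdentityOn (MonoidHom.id A) α)
    (hα : α ≠ 0) : IsPIAlgebra K A := by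
  let word (σ : Equiv.Perm (Fin n)) : FreeMonoid ℕ :=
    FreeMonoid.ofList (List.ofFn fun i => (σ i : ℕ))
  have hword : Function.Injective word := fun σ τ hστ => Equiv.ext fun i =>
    Fin.ext (congrFun (List.ofFn_injective (FreeMonoid.ofList.injective hστ)) i)
  have hindep : LinearIndependent K (FreeAlgebra.basisFreeMonoid K ℕ ∘ word) :=
    (FreeAlgebra.basisFreeMonoid K ℕ).linearIndependent.comp word hword
  refine ⟨∑ σ, α σ • FreeAlgebra.basisFreeMonoid K ℕ (word σ), fun h0 => ?_, fun x => ?_⟩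
  · exact hα (funext (Fintype.linearIndependent_iff.1 hindep α h0))
  · rw [map_sum, ← h fun i => x i]
    refine Finset.sum_congr rfl fun σ _ => ?_
    rw [map_smul, basisFreeMonoid_apply, map_list_prod, List.map_map]
    simp [word, List.map_ofFn, Function.comp_def]

end MultilinearIdentities

section GoodWords

/-- A word is `d`-good if it has no strictly decreasing subword of length `d`. -/
def IsGoodWord {β : Type*} [LT β] (d : ℕ) (w : List β) : Prop :=
  ∀ l : List β, l.Sublist w → l.Pairwise (· > ·) → l.length ≠ d

theorem exists_eq_append_flatten_of_sublist {β : Type*} {l w : List β} (h : l.Sublist w) :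
    ∃ (w₀ : List β) (us : List (List β)),
      w = w₀ ++ us.flatten ∧ us.map List.head? = l.map some := by
  induction h with
  | slnil => exact ⟨[], [], rfl, rfl⟩
  | cons a _ ih =>
    obtain ⟨w₀, us, rfl, hus⟩ := ih
    exact ⟨a :: w₀, us, rfl, hus⟩
  | cons_cons a _ ih =>
    obtain ⟨w₀, us, rfl, hus⟩ := ih
    exact ⟨[], (a :: w₀) :: us, by simp, by simp [hus]⟩

theorem flatten_lt_flatten_of_perm {β : Type*} [LinearOrder β] {us vs : List (List β)}
    {l : List β} (hus : us.map List.head? = l.map some) (hl : l.Pairwise (· > ·))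
    (hperm : vs.Perm us) (hne : vs ≠ us) : vs.flatten < us.flatten := by
  induction us generalizing vs l with
  | nil => exact absurd hperm.eq_nil hne
  | cons u us ih =>
    obtain _ | ⟨y, l⟩ := l
    · simp at hus
    obtain _ | ⟨v, vs⟩ := vs
    · exact absurd hperm.symm.eq_nil (List.cons_ne_nil _ _)
    rw [List.map_cons, List.map_cons, List.cons.injEq] at hus
    rw [List.pairwise_cons] at hl
    rw [List.flatten_cons, List.flatten_cons]
    by_cases huv : v = u
    · subst huv
      exact List.append_left_lt (ih hus.2 hl.2 hperm.cons_inv fun h => hne (by rw [h]))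
    · have hv : v ∈ us := (List.mem_cons.1 (hperm.subset List.mem_cons_self)).resolve_left huv
      obtain ⟨y', hy', hvy⟩ := List.mem_map.1 (hus.2 ▸ List.mem_map_of_mem (f := List.head?) hv)
      obtain ⟨u', rfl⟩ : ∃ u', u = y :: u' := List.head?_eq_some_iff.1 hus.1
      obtain ⟨v', rfl⟩ : ∃ v', v = y' :: v' := List.head?_eq_some_iff.1 hvy.symm
      exact List.Lex.rel (hl.1 y' hy')

/-- The blocks `u i` start with the letters of a decreasing subword of length `d`. -/
theorem exists_blocks_of_not_isGoodWord {β : Type*} [LinearOrder β] {d : ℕ} {w : List β}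
    (hw : ¬ IsGoodWord d w) :
    ∃ (w₀ : List β) (u : Fin d → List β), w = w₀ ++ (List.ofFn u).flatten ∧
      ∀ σ : Equiv.Perm (Fin d), σ ≠ 1 → w₀ ++ (List.ofFn (u ∘ σ)).flatten < w := by
  obtain ⟨l, hlw, hl, rfl⟩ : ∃ l : List β, l.Sublist w ∧ l.Pairwise (· > ·) ∧ l.length = d := by
    simpa [IsGoodWord] using hw
  obtain ⟨w₀, us, rfl, hus⟩ := exists_eq_append_flatten_of_sublist hlw
  have hlen : us.length = l.length := by simpa using congrArg List.length hus
  have hnodup : us.Nodup := List.Nodup.of_map List.head? <|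
    hus ▸ List.Nodup.map (Option.some_injective β) (hl.imp fun h => h.ne')
  obtain ⟨u, rfl⟩ : ∃ u : Fin l.length → List β, us = List.ofFn u := by
    rw [← hlen]
    exact ⟨us.get, (List.ofFn_get us).symm⟩
  refine ⟨w₀, u, rfl, fun σ hσ => List.append_left_lt ?_⟩
  refine flatten_lt_flatten_of_perm hus hl (σ.ofFn_comp_perm u) fun h => hσ ?_
  exact Equiv.ext fun i => List.nodup_ofFn.1 hnodup (congrFun (List.ofFn_injective h) i)

end GoodWords

section Latyshev

variable {K M A : Type*} [Field K] [Monoid M] [Ring A] [Algebra K A] (j : M →* A)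

/-- The value in `A` of a word in `n` letters, as a function of the elements of `M` substituted
for its letters. -/
def wordEval {n : ℕ} (w : List (Fin n)) (x : Fin n → M) : A := j (w.map x).prod

variable {j} {n d : ℕ} {α : Equiv.Perm (Fin d) → K}

theorem IsMultilinearIdentityOn.sum_smul_wordEval_eq_zero (hid : IsMultilinearIdentityOn j α)
    (w₀ : List (Fin n)) (u : Fin d → List (Fin n)) :
    ∑ σ : Equiv.Perm (Fin d), α σ • wordEval j (w₀ ++ (List.ofFn (u ∘ σ)).flatten) = 0 := by
  funext x
  have hflatten (σ : Equiv.Perm (Fin d)) : wordEval j (w₀ ++ (List.ofFn (u ∘ σ)).flatten) x =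
      wordEval j w₀ x * j (List.ofFn fun i => ((u (σ i)).map x).prod).prod := by
    simp [wordEval, List.prod_flatten, List.map_ofFn, List.map_flatten, Function.comp_def]
  simp only [Finset.sum_apply, Pi.smul_apply, hflatten, ← mul_smul_comm, ← Finset.mul_sum]
  rw [hid fun i => ((u i).map x).prod, mul_zero, Pi.zero_apply]

theorem IsMultilinearIdentityOn.wordEval_mem_span (hid : IsMultilinearIdentityOn j α)
    (hα : α 1 ≠ 0) (w₀ : List (Fin n)) (u : Fin d → List (Fin n)) :
    wordEval j (w₀ ++ (List.ofFn u).flatten) ∈ Submodule.span K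
      ((fun σ : Equiv.Perm (Fin d) => wordEval j (w₀ ++ (List.ofFn (u ∘ σ)).flatten)) ''
        {σ | σ ≠ 1}) := by
  have hsum := hid.sum_smul_wordEval_eq_zero w₀ u
  rw [← Finset.add_sum_erase _ _ (Finset.mem_univ 1)] at hsum
  refine (Submodule.smul_mem_iff _ hα).1 ?_
  rw [show u = u ∘ (1 : Equiv.Perm (Fin d)) from rfl, eq_neg_of_add_eq_zero_left hsum]
  refine Submodule.neg_mem _ (Submodule.sum_mem _ fun σ hσ => Submodule.smul_mem _ _ ?_)
  exact Submodule.subset_span ⟨σ, Finset.ne_of_mem_erase hσ, rfl⟩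

/-- Applying the identity to the blocks cut out by a decreasing subword rewrites a bad word in
terms of lexicographically smaller ones. -/
theorem IsMultilinearIdentityOn.wordEval_mem_span_isGoodWord (hid : IsMultilinearIdentityOn j α)
    (hα : α 1 ≠ 0) (w : List (Fin n)) :
    wordEval j w ∈ Submodule.span K (wordEval j '' {v | v.Perm w ∧ IsGoodWord d v}) := by
  have hwf := (List.finite_length_eq (Fin n) w.length).wellFoundedOn (r := (· < ·))
  refine hwf.induction (P := fun v => wordEval j v ∈
    Submodule.span K (wordEval j '' {v' | v'.Perm v ∧ IsGoodWord d v'})) rfl fun v hv ih => ?_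
  by_cases hgood : IsGoodWord d v
  · exact Submodule.subset_span ⟨v, ⟨List.Perm.refl v, hgood⟩, rfl⟩
  obtain ⟨w₀, u, rfl, hlt⟩ := exists_blocks_of_not_isGoodWord hgood
  refine Submodule.span_le.2 ?_ (hid.wordEval_mem_span hα w₀ u)
  rintro _ ⟨σ, hσ, rfl⟩
  have hperm : (w₀ ++ (List.ofFn (u ∘ σ)).flatten).Perm (w₀ ++ (List.ofFn u).flatten) :=
    List.Perm.append_left w₀ (σ.ofFn_comp_perm u).flatten
  refine Submodule.span_mono (Set.image_mono ?_) (ih _ (hperm.length_eq.trans hv) (hlt σ hσ))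
  exact fun v' hv' => ⟨hv'.1.trans hperm, hv'.2⟩

theorem exists_perm_eq_ofFn {v : List (Fin n)} {π : Equiv.Perm (Fin n)}
    (hv : v.Perm (List.ofFn π)) : ∃ ρ : Equiv.Perm (Fin n), v = List.ofFn ρ := by
  obtain ⟨f, rfl⟩ : ∃ f : Fin n → Fin n, v = List.ofFn f := by
    have hlen : v.length = n := by simpa using hv.length_eq
    exact ⟨v.get ∘ Fin.cast hlen.symm,
      (List.ofFn_get v).symm.trans (List.ofFn_congr hlen v.get)⟩
  have hf : Function.Injective f := by
    rw [← List.nodup_ofFn, hv.nodup_iff, List.nodup_ofFn]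
    exact π.injective
  exact ⟨Equiv.ofBijective f (Finite.injective_iff_bijective.1 hf), rfl⟩

theorem IsMultilinearIdentityOn.wordEval_perm_mem_span (hid : IsMultilinearIdentityOn j α)
    (hα : α 1 ≠ 0) (π : Equiv.Perm (Fin n)) :
    wordEval j (List.ofFn π) ∈ Submodule.span K (Set.range
      fun ρ : {ρ : Equiv.Perm (Fin n) // IsGoodWord d (List.ofFn ρ)} =>
        wordEval j (List.ofFn ρ.1)) := by
  refine Submodule.span_mono ?_ (hid.wordEval_mem_span_isGoodWord hα (List.ofFn π))
  rintro _ ⟨v, ⟨hv, hgood⟩, rfl⟩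
  obtain ⟨ρ, rfl⟩ := exists_perm_eq_ofFn hv
  exact ⟨⟨ρ, hgood⟩, rfl⟩

end Latyshev

section Colouring

/-- The largest size of a decreasing subfamily of `f` that ends at the index `i`. -/
noncomputable def decreasingHeight {n : ℕ} {β : Type*} [Preorder β] (f : Fin n → β) (i : Fin n) :
    ℕ :=
  open Classical in
  Finset.sup {s : Finset (Fin n) | IsGreatest (s : Set (Fin n)) i ∧ StrictAntiOn f s} Finset.card

variable {n d : ℕ} {β : Type*}

theorem decreasingHeight_lt_of_lt [Preorder β] {f : Fin n → β} {i j : Fin n} (hij : i < j)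
    (hf : f j < f i) : decreasingHeight f i < decreasingHeight f j := by
  classical
  obtain ⟨s, hs, hcard⟩ := Finset.exists_mem_eq_sup
    {s : Finset (Fin n) | IsGreatest (s : Set (Fin n)) i ∧ StrictAntiOn f s}
    ⟨{i}, by simp⟩ Finset.card
  obtain ⟨⟨his, hsi⟩, hanti⟩ := (Finset.mem_filter.1 hs).2
  have hlt (a : Fin n) (ha : a ∈ s) : a < j := (hsi ha).trans_lt hij
  have hflt (a : Fin n) (ha : a ∈ s) : f j < f a := hf.trans_le (hanti.antitoneOn ha his (hsi ha))
  have hgreatest : IsGreatest (insert j s : Finset (Fin n)) j := by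
    refine ⟨Finset.mem_insert_self j s, fun a ha => ?_⟩
    rcases Finset.mem_insert.1 ha with rfl | ha
    exacts [le_rfl, (hlt a ha).le]
  have hanti' : StrictAntiOn f (insert j s : Finset (Fin n)) := by
    intro a ha b hb hab
    rcases Finset.mem_insert.1 hb with rfl | hb
    · exact hflt a ((Finset.mem_insert.1 ha).resolve_left hab.ne)
    · refine hanti ((Finset.mem_insert.1 ha).resolve_left fun h => ?_) hb hab
      exact (hlt b hb).asymm (h ▸ hab)
  calc decreasingHeight f i
    _ = s.card := by rw [decreasingHeight, ← hcard]
    _ < (insert j s).card := Finset.card_lt_card (Finset.ssubset_insert fun h => (hlt j h).false)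
    _ ≤ decreasingHeight f j := Finset.le_sup (f := Finset.card)
      (Finset.mem_filter.2 ⟨Finset.mem_univ _, hgreatest, hanti'⟩)

theorem IsGoodWord.card_lt [Preorder β] {f : Fin n → β} (hf : IsGoodWord d (List.ofFn f))
    {s : Finset (Fin n)} (hs : StrictAntiOn f s) : s.card < d := by
  by_contra! hcard
  let l := (s.sort (· ≤ ·)).map f
  have hsub : l.Sublist (List.ofFn f) := by
    rw [List.ofFn_eq_map]
    exact (List.sublist_of_subperm_of_sortedLE
      ((s.sort_nodup (· ≤ ·)).subperm fun a _ => List.mem_finRange a)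
      (Finset.sortedLT_sort s).sortedLE (List.sortedLT_finRange n).sortedLE).map f
  have hdecr : l.Pairwise (· > ·) := by
    rw [List.pairwise_map]
    exact (Finset.sortedLT_sort s).pairwise.imp_of_mem fun ha hb hab =>
      hs (by simpa using ha) (by simpa using hb) hab
  have hlen : l.length = s.card := by simp [l]
  refine hf (l.take d) ((List.take_sublist d l).trans hsub)
    (hdecr.sublist (List.take_sublist d l)) ?_
  rw [List.length_take, hlen, min_eq_left hcard]

theorem IsGoodWord.decreasingHeight_lt [Preorder β] {f : Fin n → β}
    (hf : IsGoodWord d (List.ofFn f)) (i : Fin n) : decreasingHeight f i < d := by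
  classical
  have hd : 0 < d := by simpa using hf.card_lt (s := ∅) (by simp [StrictAntiOn])
  exact (Finset.sup_lt_iff hd).2 fun s hs => hf.card_lt (Finset.mem_filter.1 hs).2.2

theorem IsGoodWord.exists_coloring [LinearOrder β] {f : Fin n → β}
    (hf : IsGoodWord d (List.ofFn f)) : ∃ c : Fin n → Fin d, ∀ a, MonotoneOn f (c ⁻¹' {a}) := by
  refine ⟨fun i => ⟨decreasingHeight f i, hf.decreasingHeight_lt i⟩, fun a i hi j hj hij => ?_⟩
  by_contra! hlt
  have hij' : i < j := lt_of_le_of_ne hij fun h => hlt.ne (h ▸ rfl)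
  exact (decreasingHeight_lt_of_lt hij' hlt).ne (Fin.mk.inj_iff.1 (Eq.trans hi hj.symm))

variable {γ : Type*} {c : Fin n → γ} {ρ ρ' : Equiv.Perm (Fin n)}

theorem not_lt_of_monotoneOn_colors (hρ' : ∀ a, MonotoneOn ρ' (c ⁻¹' {a}))
    (hc : ∀ i, c (ρ.symm i) = c (ρ'.symm i)) {i : Fin n} (ih : ∀ j < i, ρ j = ρ' j) :
    ¬ ρ i < ρ' i := by
  intro hlt
  obtain ⟨j, hj⟩ := ρ'.surjective (ρ i)
  have hcj : c j = c i := by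
    rw [← ρ.symm_apply_apply i, hc, ← hj, Equiv.symm_apply_apply]
  have hji : j < i := by
    by_contra! hij
    exact (hj ▸ hρ' (c i) rfl hcj hij).not_gt hlt
  exact hji.ne (ρ.injective ((ih j hji).trans hj))

theorem perm_eq_of_monotoneOn_colors (hρ : ∀ a, MonotoneOn ρ (c ⁻¹' {a}))
    (hρ' : ∀ a, MonotoneOn ρ' (c ⁻¹' {a})) (hc : ∀ i, c (ρ.symm i) = c (ρ'.symm i)) : ρ = ρ' := by
  ext1 i
  induction i using WellFoundedLT.induction with
  | ind i ih =>
    exact le_antisymm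
      (not_lt.1 (not_lt_of_monotoneOn_colors hρ (fun i => (hc i).symm) fun j hj => (ih j hj).symm))
      (not_lt.1 (not_lt_of_monotoneOn_colors hρ' hc ih))

/-- A good permutation is determined by the colours of the positions and of the values. -/
theorem card_isGoodWord_le
    [DecidablePred fun ρ : Equiv.Perm (Fin n) => IsGoodWord d (List.ofFn ρ)] :
    Fintype.card {ρ : Equiv.Perm (Fin n) // IsGoodWord d (List.ofFn ρ)} ≤ (d * d) ^ n := by
  choose c hc using fun ρ : {ρ : Equiv.Perm (Fin n) // IsGoodWord d (List.ofFn ρ)} =>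
    ρ.2.exists_coloring
  have hinj : Function.Injective (fun ρ i => (c ρ i, c ρ (ρ.1.symm i)) : _ → Fin n → _) := by
    intro ρ ρ' h
    have hpos : c ρ = c ρ' := funext fun i => congrArg Prod.fst (congrFun h i)
    have hval (i : Fin n) : c ρ (ρ.1.symm i) = c ρ (ρ'.1.symm i) :=
      (congrArg Prod.snd (congrFun h i)).trans (congrFun hpos _).symm
    exact Subtype.ext (perm_eq_of_monotoneOn_colors (hc ρ) (hpos ▸ hc ρ') hval)
  simpa using Fintype.card_le_of_injective _ hinj

theorem exists_pow_lt_factorial (c : ℕ) : ∃ n : ℕ, c ^ n < n.factorial := by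
  have h := FloorSemiring.tendsto_pow_div_factorial_atTop (c : ℝ)
  obtain ⟨n, hn⟩ := (h.eventually (gt_mem_nhds zero_lt_one)).exists
  rw [div_lt_one (by positivity)] at hn
  exact ⟨n, mod_cast hn⟩

end Colouring

section Regev

variable {K A M : Type*} [Field K] [Ring A] [Algebra K A] [Monoid M]

theorem IsMultilinearIdentityOn.of_span_eq_top {n : ℕ} {γ : Equiv.Perm (Fin n) → K} {j : M →* A}
    (h : IsMultilinearIdentityOn j γ) (hspan : Submodule.span K (Set.range j) = ⊤) :
    IsMultilinearIdentityOn (MonoidHom.id A) γ := by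
  let P : MultilinearMap K (fun _ : Fin n => A) A :=
    ∑ π : Equiv.Perm (Fin n), γ π • (MultilinearMap.mkPiAlgebraFin K n A).domDomCongr π
  have hP (z : Fin n → A) : P z = ∑ π, γ π • (List.ofFn fun i => z (π i)).prod := by
    simp [P]
  have hzero : P = 0 := by
    refine Module.Basis.ext_multilinear (fun _ => Module.Basis.ofSpan hspan.ge) fun v => ?_
    choose x hx using fun i => Module.Basis.ofSpan_subset hspan.ge ⟨v i, rfl⟩
    rw [hP, zero_apply, ← h x]
    refine Finset.sum_congr rfl fun π _ => ?_
    rw [map_list_prod, List.map_ofFn]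
    simp only [← hx, Function.comp_def]
  intro z
  simp only [MonoidHom.id_apply, ← hP, hzero, zero_apply]

theorem IsMultilinearIdentityOn.of_algHom {K₁ G : Type*} [Field K₁] [Ring G] [Algebra K₁ G]
    [Algebra K₁ K] [Algebra K₁ A] [IsScalarTower K₁ K A] (f : G →ₐ[K₁] A) {d : ℕ}
    {α : Equiv.Perm (Fin d) → K₁} (h : IsMultilinearIdentityOn (MonoidHom.id G) α) :
    IsMultilinearIdentityOn (f : G →* A) fun σ => algebraMap K₁ K (α σ) := by
  intro z
  have hz := congrArg f (h z)
  rw [map_sum, map_zero] at hz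
  simp only [map_smul] at hz
  simp only [algebraMap_smul]
  exact hz

theorem IsMultilinearIdentityOn.comp {N : Type*} [Monoid N] {j : M →* A} {d : ℕ}
    {α : Equiv.Perm (Fin d) → K} (h : IsMultilinearIdentityOn j α) (φ : N →* M) :
    IsMultilinearIdentityOn (j.comp φ) α := by
  intro z
  simpa only [MonoidHom.comp_apply, map_list_prod φ, List.map_ofFn, Function.comp_def] using
    h (φ ∘ z)

/-- The products of good word values are too few for the `n!` products of word values to be
linearly independent. -/
theorem exists_isMultilinearIdentityOn_mul {j j₁ j₂ : M →* A} (hj : ∀ x, j x = j₁ x * j₂ x)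
    {d₁ d₂ : ℕ} {α₁ : Equiv.Perm (Fin d₁) → K} {α₂ : Equiv.Perm (Fin d₂) → K}
    (h₁ : IsMultilinearIdentityOn j₁ α₁) (hα₁ : α₁ 1 ≠ 0)
    (h₂ : IsMultilinearIdentityOn j₂ α₂) (hα₂ : α₂ 1 ≠ 0) :
    ∃ (n : ℕ) (γ : Equiv.Perm (Fin n) → K), γ ≠ 0 ∧ IsMultilinearIdentityOn j γ := by
  classical
  obtain ⟨n, hn⟩ := exists_pow_lt_factorial ((d₁ * d₁) * (d₂ * d₂))
  let Good (d : ℕ) := {ρ : Equiv.Perm (Fin n) // IsGoodWord d (List.ofFn ρ)}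
  let q (p : Good d₁ × Good d₂) : (Fin n → M) → A :=
    wordEval j₁ (List.ofFn p.1.1) * wordEval j₂ (List.ofFn p.2.1)
  let P (π : Equiv.Perm (Fin n)) : (Fin n → M) → A := wordEval j (List.ofFn π)
  have hmem : Set.range P ≤ Submodule.span K (Set.range q) := by
    rintro _ ⟨π, rfl⟩
    have hP : P π = wordEval j₁ (List.ofFn π) * wordEval j₂ (List.ofFn π) := funext fun x => hj _
    have hmul := Submodule.mul_mem_mul (h₁.wordEval_perm_mem_span hα₁ π)
      (h₂.wordEval_perm_mem_span hα₂ π)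
    rw [Submodule.span_mul_span, ← hP] at hmul
    refine Submodule.span_mono ?_ hmul
    rintro _ ⟨_, ⟨ρ, rfl⟩, _, ⟨ρ', rfl⟩, rfl⟩
    exact ⟨(ρ, ρ'), rfl⟩
  have hcard : Fintype.card (Set.range q) < Fintype.card (Equiv.Perm (Fin n)) := by
    calc Fintype.card (Set.range q)
      _ ≤ Fintype.card (Good d₁ × Good d₂) :=
        Fintype.card_le_of_surjective _ Set.rangeFactorization_surjective
      _ ≤ (d₁ * d₁) ^ n * (d₂ * d₂) ^ n := by
        rw [Fintype.card_prod]
        exact Nat.mul_le_mul card_isGoodWord_le card_isGoodWord_le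
      _ < n.factorial := by rwa [← mul_pow]
      _ = Fintype.card (Equiv.Perm (Fin n)) := by rw [Fintype.card_perm, Fintype.card_fin]
  have hdep : ¬ LinearIndependent K P := fun hli =>
    hcard.not_ge (linearIndependent_le_span_aux' P hli (Set.range q) hmem)
  obtain ⟨γ, hγ, i, hi⟩ := Fintype.not_linearIndependent_iff.1 hdep
  refine ⟨n, γ, fun h => hi (congrFun h i), fun z => ?_⟩
  simpa [P, wordEval, List.map_ofFn, Function.comp_def] using congrFun hγ z

/-- Regev's theorem on tensor products of polynomial identity algebras. -/
theorem IsCommProduct.isPIAlgebra {K₁ K₂ G₁ G₂ : Type*} [Field K₁] [Field K₂] [Ring G₁] [Ring G₂]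
    [Algebra K₁ G₁] [Algebra K₂ G₂] [Algebra K₁ K] [Algebra K₂ K] [Algebra K₁ A] [Algebra K₂ A]
    [IsScalarTower K₁ K A] [IsScalarTower K₂ K A] {α₁ : G₁ →ₐ[K₁] A} {α₂ : G₂ →ₐ[K₂] A}
    (h : IsCommProduct K α₁ α₂) (h₁ : IsPIAlgebra K₁ G₁) (h₂ : IsPIAlgebra K₂ G₂) :
    IsPIAlgebra K A := by
  obtain ⟨d₁, c₁, hc₁, hid₁⟩ := h₁.exists_isMultilinearIdentityOn
  obtain ⟨d₂, c₂, hc₂, hid₂⟩ := h₂.exists_isMultilinearIdentityOn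
  let j : G₁ × G₂ →* A := (α₁ : G₁ →* A).noncommCoprod (α₂ : G₂ →* A) h.commute
  obtain ⟨n, γ, hγ, hid⟩ := exists_isMultilinearIdentityOn_mul (K := K) (j := j) (fun _ => rfl)
    ((hid₁.of_algHom α₁).comp (MonoidHom.fst G₁ G₂)) (by simpa using hc₁)
    ((hid₂.of_algHom α₂).comp (MonoidHom.snd G₁ G₂)) (by simpa using hc₂)
  exact (hid.of_span_eq_top h.span_eq_top).isPIAlgebra hγ

end Regev

/-! ### Congeniality of products -/

section Reduction

/-- Every base change of the `D`-algebra `G` to a finite field that is a factor ring of `D` is a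
finitely generated polynomial identity algebra. -/
def HasFinitePIReductions (D G : Type u) [CommRing D] [Ring G] [Algebra D G] : Prop :=
  ∀ (L : Type u) [Field L] [Finite L] [Algebra D L], Function.Surjective (algebraMap D L) →
    Algebra.FiniteType L (L ⊗[D] G) ∧ IsPIAlgebra L (L ⊗[D] G)

theorem exists_finite_field_factor (D K : Type u) [CommRing D] [Field K] [Finite K] [Algebra D K] :
    ∃ (L : Type u) (_ : Field L) (_ : Finite L) (_ : Algebra D L) (_ : Algebra L K),
      IsScalarTower D L K ∧ Function.Surjective (algebraMap D L) := by
  let I := RingHom.ker (algebraMap D K)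
  have hfin : Finite (D ⧸ I) := Finite.of_injective _ (RingHom.kerLift_injective (algebraMap D K))
  have hprime : I.IsPrime := RingHom.ker_isPrime _
  have hmax : I.IsMaximal :=
    Ideal.Quotient.maximal_of_isField I (Finite.isDomain_to_isField (D ⧸ I))
  let := Ideal.Quotient.field I
  let := (RingHom.kerLift (algebraMap D K)).toAlgebra
  exact ⟨D ⧸ I, inferInstance, hfin, inferInstance, inferInstance,
    IsScalarTower.of_algebraMap_eq fun _ => rfl, Ideal.Quotient.mk_surjective⟩

namespace IsCommProduct

variable {D D₁ D₂ G₁ G₂ X : Type u} [CommRing D] [CommRing D₁] [CommRing D₂] [Ring G₁] [Ring G₂]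
  [Ring X] [Algebra D₁ G₁] [Algebra D₂ G₂] [Algebra D X] [Algebra D₁ X] [Algebra D₂ X]
  [Algebra D₁ D] [Algebra D₂ D] [IsScalarTower D₁ D X] [IsScalarTower D₂ D X]
  {α₁ : G₁ →ₐ[D₁] X} {α₂ : G₂ →ₐ[D₂] X}

theorem finiteType_and_isPIAlgebra {K : Type u} [Field K] [Finite K] [Algebra K X] [Algebra D₁ K]
    [Algebra D₂ K] [IsScalarTower D₁ K X] [IsScalarTower D₂ K X] (h : IsCommProduct K α₁ α₂)
    (h₁ : HasFinitePIReductions D₁ G₁) (h₂ : HasFinitePIReductions D₂ G₂) :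
    Algebra.FiniteType K X ∧ IsPIAlgebra K X := by
  obtain ⟨L₁, _, _, _, _, _, hL₁⟩ := exists_finite_field_factor D₁ K
  obtain ⟨L₂, _, _, _, _, _, hL₂⟩ := exists_finite_field_factor D₂ K
  let := Algebra.compHom X (algebraMap L₁ K)
  let := Algebra.compHom X (algebraMap L₂ K)
  have : IsScalarTower L₁ K X := IsScalarTower.of_algebraMap_eq fun _ => rfl
  have : IsScalarTower L₂ K X := IsScalarTower.of_algebraMap_eq fun _ => rfl
  have : IsScalarTower D₁ L₁ X := IsScalarTower.to₁₂₄ D₁ L₁ K X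
  have : IsScalarTower D₂ L₂ X := IsScalarTower.to₁₂₄ D₂ L₂ K X
  obtain ⟨hft₁, hpi₁⟩ := h₁ L₁ hL₁
  obtain ⟨hft₂, hpi₂⟩ := h₂ L₂ hL₂
  have hext := h.extend (K₁ := L₁) (K₂ := L₂)
  exact ⟨hext.finiteType hft₁ hft₂, hext.isPIAlgebra hpi₁ hpi₂⟩

theorem isNoethRing_of_gr (h : IsCommProduct D α₁ α₂) (hD : IsNoetherianRing D)
    (F₁ : AlgFiltration D₁ G₁) (F₂ : AlgFiltration D₂ G₂)
    (h₁ : IsUniversallyNoetherian D₁ F₁.Gr) (h₂ : IsStronglyNoetherian D₂ F₂.Gr) :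
    IsNoethRing X :=
  (AlgFiltration.product F₁ F₂ h).isNoethRing_of_gr
    (((AlgFiltration.isProduct_product h).gr h.commute).isNoethRing hD h₁ h₂)

theorem reduction (h : IsCommProduct D α₁ α₂)
    (F₁ : AlgFiltration D₁ G₁) (F₂ : AlgFiltration D₂ G₂)
    (hF₁ : IsUniversallyNoetherian D₁ F₁.Gr) (hF₂ : IsStronglyNoetherian D₂ F₂.Gr)
    (h₁ : HasFinitePIReductions D₁ G₁) (h₂ : HasFinitePIReductions D₂ G₂)
    (K : Type u) [Field K] [Finite K] [Algebra D K] :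
    Algebra.FiniteType K (K ⊗[D] X) ∧ IsNoethRing (K ⊗[D] X) ∧ IsPIAlgebra K (K ⊗[D] X) := by
  let := Algebra.compHom K (algebraMap D₁ D)
  let := Algebra.compHom K (algebraMap D₂ D)
  have : IsScalarTower D₁ D K := IsScalarTower.of_algebraMap_eq fun _ => rfl
  have : IsScalarTower D₂ D K := IsScalarTower.of_algebraMap_eq fun _ => rfl
  have hK := h.baseChange (C := K)
  obtain ⟨hft, hpi⟩ := hK.finiteType_and_isPIAlgebra h₁ h₂
  exact ⟨hft, hK.isNoethRing_of_gr inferInstance F₁ F₂ hF₁ hF₂, hpi⟩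

end IsCommProduct

theorem AlgFiltration.IsCongenialWith.hasFinitePIReductions {k A : Type u} [Field k] [Ring A]
    [Algebra k A] {F : AlgFiltration k A} {D : Subalgebra ℤ k} {B : Subalgebra D A}
    (h : F.IsCongenialWith D B) : HasFinitePIReductions D B :=
  fun L _ _ _ hL => ⟨(h.reduction L hL).1, (h.reduction L hL).2.2⟩

end Reduction

section ProductSubalgebra

variable {R S₁ S₂ G₁ G₂ X : Type*} [CommRing R] [CommRing S₁] [CommRing S₂] [Ring G₁] [Ring G₂]
  [Ring X] [Algebra S₁ G₁] [Algebra S₂ G₂] [Algebra R X] [Algebra S₁ X] [Algebra S₂ X]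
  {α₁ : G₁ →ₐ[S₁] X} {α₂ : G₂ →ₐ[S₂] X} (hc : ∀ a b, Commute (α₁ a) (α₂ b))

variable (R) in
/-- The subalgebra spanned over `R` by the products of elements of the images of two commuting
homomorphisms. -/
def productSubalgebra : Subalgebra R X :=
  (Submodule.span R (Set.range fun p : G₁ × G₂ => α₁ p.1 * α₂ p.2)).toSubalgebra
    (Submodule.subset_span ⟨1, by simp only [Prod.fst_one, Prod.snd_one, map_one, mul_one]⟩)
    fun x y hx hy => by
      have hxy := Submodule.mul_mem_mul hx hy
      rw [Submodule.span_mul_span] at hxy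
      refine Submodule.span_mono ?_ hxy
      rintro _ ⟨_, ⟨⟨a, b⟩, rfl⟩, _, ⟨⟨a', b'⟩, rfl⟩, rfl⟩
      refine ⟨(a * a', b * b'), ?_⟩
      simp only [map_mul]
      exact ((hc a' b).symm.mul_mul_mul_comm _ _).symm

theorem mul_mem_productSubalgebra (a : G₁) (b : G₂) : α₁ a * α₂ b ∈ productSubalgebra R hc :=
  Submodule.subset_span ⟨(a, b), rfl⟩

theorem left_mem_productSubalgebra (a : G₁) : α₁ a ∈ productSubalgebra R hc := by
  simpa only [map_one, mul_one] using mul_mem_productSubalgebra (R := R) hc a 1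

theorem right_mem_productSubalgebra (b : G₂) : α₂ b ∈ productSubalgebra R hc := by
  simpa only [map_one, one_mul] using mul_mem_productSubalgebra (R := R) hc 1 b

variable [Algebra S₁ R] [Algebra S₂ R] [IsScalarTower S₁ R X] [IsScalarTower S₂ R X]

variable (R) in
/-- The first factor, mapped to the product subalgebra. -/
def productSubalgebraLeft : G₁ →ₐ[S₁] productSubalgebra R hc :=
  α₁.codRestrict ((productSubalgebra R hc).restrictScalars S₁) (left_mem_productSubalgebra hc)

variable (R) in
/-- The second factor, mapped to the product subalgebra. -/
def productSubalgebraRight : G₂ →ₐ[S₂] productSubalgebra R hc :=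
  α₂.codRestrict ((productSubalgebra R hc).restrictScalars S₂) (right_mem_productSubalgebra hc)

theorem isCommProduct_productSubalgebra :
    IsCommProduct R (productSubalgebraLeft R hc) (productSubalgebraRight R hc) where
  commute a b := Subtype.ext (hc a b)
  span_eq_top := by
    refine Submodule.map_injective_of_injective
      (f := (productSubalgebra R hc).val.toLinearMap) Subtype.val_injective ?_
    rw [Submodule.map_span, ← Set.range_comp, Submodule.map_top]
    exact (Submodule.range_subtype (Subalgebra.toSubmodule (productSubalgebra R hc))).symm

end ProductSubalgebra

namespace AlgFiltration.IsProduct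

section Induced

variable {k D D₁ D₂ A₁ A₂ A : Type*} [Field k] [CommRing D] [CommRing D₁] [CommRing D₂]
  [Algebra D k] [Algebra D₁ k] [Algebra D₂ k] [Algebra D₁ D] [Algebra D₂ D]
  [Ring A₁] [Ring A₂] [Ring A] [Algebra k A₁] [Algebra k A₂] [Algebra k A]
  [Algebra D₁ A₁] [Algebra D₂ A₂] [Algebra D A] [Algebra D₁ A] [Algebra D₂ A]
  [IsScalarTower D₁ k A₁] [IsScalarTower D₂ k A₂] [IsScalarTower D k A]
  [IsScalarTower D₁ D A] [IsScalarTower D₂ D A]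
  {B₁ : Subalgebra D₁ A₁} {B₂ : Subalgebra D₂ A₂} {B : Subalgebra D A}
  {F₁ : AlgFiltration k A₁} {F₂ : AlgFiltration k A₂} {F : AlgFiltration k A}
  {j₁ : A₁ →ₐ[k] A} {j₂ : A₂ →ₐ[k] A} {i₁ : B₁ →ₐ[D₁] B} {i₂ : B₂ →ₐ[D₂] B}

theorem isOrder_val (hDk : Function.Injective (algebraMap D k)) (e : A₁ ⊗[k] A₂ ≃ₗ[k] A)
    (he : ∀ a b, e (a ⊗ₜ b) = j₁ a * j₂ b) (hi₁ : ∀ b, (i₁ b : A) = j₁ b)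
    (hi₂ : ∀ b, (i₂ b : A) = j₂ b) (h₁ : IsOrder k B₁.val) (h₂ : IsOrder k B₂.val)
    (hi : IsCommProduct D i₁ i₂) : IsOrder k B.val := by
  refine hi.isOrder hDk h₁ h₂ e fun v w => ?_
  change ((i₁ v * i₂ w : B) : A) = e ((v : A₁) ⊗ₜ (w : A₂))
  rw [Subalgebra.coe_mul, hi₁, hi₂, he]

theorem isOrder_grMap (hDk : Function.Injective (algebraMap D k)) (hF : IsProduct F₁ F₂ F j₁ j₂)
    (hc : ∀ a b, Commute (j₁ a) (j₂ b)) (e : A₁ ⊗[k] A₂ ≃ₗ[k] A)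
    (he : ∀ a b, e (a ⊗ₜ b) = j₁ a * j₂ b) (hi₁ : ∀ b, (i₁ b : A) = j₁ b)
    (hi₂ : ∀ b, (i₂ b : A) = j₂ b) (h₁ : IsOrder k (F₁.grIncl B₁)) (h₂ : IsOrder k (F₂.grIncl B₂))
    {M : AlgFiltration D B} (hM : IsProduct (F₁.induced B₁) (F₂.induced B₂) M i₁ i₂)
    (hi : ∀ a b, Commute (i₁ a) (i₂ b)) (hMF : M.IsFilteredHom F B.val) : IsOrder k hMF.grMap := by
  refine (hM.gr hi).isOrder hDk h₁ h₂ (hF.grTensorEquiv hc e he) fun x y => ?_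
  have hx : hMF.grMap (hM.isFilteredHom_left.grMap x) =
      hF.isFilteredHom_left.grMap (F₁.grIncl B₁ x) :=
    hMF.grMap_grMap_of_comm hF.isFilteredHom_left hM.isFilteredHom_left
      (F₁.isFilteredHom_val B₁) hi₁ x
  have hy : hMF.grMap (hM.isFilteredHom_right.grMap y) =
      hF.isFilteredHom_right.grMap (F₂.grIncl B₂ y) :=
    hMF.grMap_grMap_of_comm hF.isFilteredHom_right hM.isFilteredHom_right
      (F₂.isFilteredHom_val B₂) hi₂ y
  rw [map_mul, hx, hy]
  exact (hF.grTensorMap_tmul hc _ _).symm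

/-- The product filtration of the orders is contained in the induced one; it is all of it because
it has the right associated graded algebra. -/
theorem induced (hDk : Function.Injective (algebraMap D k)) (hF : IsProduct F₁ F₂ F j₁ j₂)
    (hc : ∀ a b, Commute (j₁ a) (j₂ b)) (e : A₁ ⊗[k] A₂ ≃ₗ[k] A)
    (he : ∀ a b, e (a ⊗ₜ b) = j₁ a * j₂ b) (hi₁ : ∀ b, (i₁ b : A) = j₁ b)
    (hi₂ : ∀ b, (i₂ b : A) = j₂ b) (h₁ : IsOrder k (F₁.grIncl B₁)) (h₂ : IsOrder k (F₂.grIncl B₂))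
    (hi : IsCommProduct D i₁ i₂) :
    IsProduct (F₁.induced B₁) (F₂.induced B₂) (F.induced B) i₁ i₂ := by
  let M : AlgFiltration D B := product (F₁.induced B₁) (F₂.induced B₂) hi
  have hM : IsProduct (F₁.induced B₁) (F₂.induced B₂) M i₁ i₂ := isProduct_product hi
  have hMF : M.IsFilteredHom F B.val := by
    refine fun n => hM.layer_le (p := (F.induced B).toFun n) fun r s hrs a ha b hb => ?_
    change ((i₁ a * i₂ b : B) : A) ∈ F.toFun n
    rw [Subalgebra.coe_mul, hi₁, hi₂]
    exact hF.mul_mem hrs ha hb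
  have hinj : Function.Injective hMF.grMap :=
    (hF.isOrder_grMap hDk hc e he hi₁ hi₂ h₁ h₂ hM hi.commute hMF).injective
  have hMB : F.induced B = M := ext_toFun fun n =>
    le_antisymm (fun _ hb => hMF.mem_of_map_mem hinj hb) (hMF n)
  exact hMB ▸ hM

end Induced

section Congenial

variable {k A₁ A₂ A : Type u} [Field k] [Ring A₁] [Ring A₂] [Ring A] [Algebra k A₁] [Algebra k A₂]
  [Algebra k A] {F₁ : AlgFiltration k A₁} {F₂ : AlgFiltration k A₂} {F : AlgFiltration k A}
  {j₁ : A₁ →ₐ[k] A} {j₂ : A₂ →ₐ[k] A}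

theorem isCongenialWith {D D₁ D₂ : Subalgebra ℤ k} [Algebra D₁ D] [Algebra D₂ D]
    [IsScalarTower D₁ D A] [IsScalarTower D₂ D A] {B₁ : Subalgebra D₁ A₁} {B₂ : Subalgebra D₂ A₂}
    {B : Subalgebra D A} {i₁ : B₁ →ₐ[D₁] B} {i₂ : B₂ →ₐ[D₂] B} (hD : D.FG)
    (hF : IsProduct F₁ F₂ F j₁ j₂) (hc : ∀ a b, Commute (j₁ a) (j₂ b)) (e : A₁ ⊗[k] A₂ ≃ₗ[k] A)
    (he : ∀ a b, e (a ⊗ₜ b) = j₁ a * j₂ b) (hi₁ : ∀ b, (i₁ b : A) = j₁ b)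
    (hi₂ : ∀ b, (i₂ b : A) = j₂ b) (hi : IsCommProduct D i₁ i₂) (h₁ : F₁.IsCongenialWith D₁ B₁)
    (huniv : IsUniversallyNoetherian D₁ (F₁.induced B₁).Gr) (h₂ : F₂.IsCongenialWith D₂ B₂) :
    F.IsCongenialWith D B := by
  have hDk : Function.Injective (algebraMap D k) := Subtype.val_injective
  have hB : IsProduct (F₁.induced B₁) (F₂.induced B₂) (F.induced B) i₁ i₂ :=
    hF.induced hDk hc e he hi₁ hi₂ h₁.gr_order h₂.gr_order hi
  have hBfinite := hB.locallyFinite h₁.order_locallyFinite h₂.order_locallyFinite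
  exact
    { affine := hD
      locallyFinite := hF.locallyFinite h₁.locallyFinite h₂.locallyFinite
      order := isOrder_val hDk e he hi₁ hi₂ h₁.order h₂.order hi
      order_locallyFinite := hBfinite
      gr_order := hF.isOrder_grMap hDk hc e he hi₁ hi₂ h₁.gr_order h₂.gr_order hB hi.commute
        (F.isFilteredHom_val B)
      gr_stronglyNoetherian :=
        (hB.gr hi.commute).isStronglyNoetherian huniv h₂.gr_stronglyNoetherian
      gr_locallyFinite := hBfinite.gr
      reduction := fun K _ _ _ _ => hi.reduction (F₁.induced B₁) (F₂.induced B₂) huniv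
        h₂.gr_stronglyNoetherian h₁.hasFinitePIReductions h₂.hasFinitePIReductions K }

theorem isCongenial {D₁ D₂ : Subalgebra ℤ k} {B₁ : Subalgebra D₁ A₁} {B₂ : Subalgebra D₂ A₂}
    (hF : IsProduct F₁ F₂ F j₁ j₂) (hc : ∀ a b, Commute (j₁ a) (j₂ b)) (e : A₁ ⊗[k] A₂ ≃ₗ[k] A)
    (he : ∀ a b, e (a ⊗ₜ b) = j₁ a * j₂ b) (h₁ : F₁.IsCongenialWith D₁ B₁)
    (huniv : IsUniversallyNoetherian D₁ (F₁.induced B₁).Gr) (h₂ : F₂.IsCongenialWith D₂ B₂) :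
    F.IsCongenial := by
  let D := D₁ ⊔ D₂
  let := (Subalgebra.inclusion (le_sup_left : D₁ ≤ D)).toRingHom.toAlgebra
  let := (Subalgebra.inclusion (le_sup_right : D₂ ≤ D)).toRingHom.toAlgebra
  have : IsScalarTower D₁ D A := IsScalarTower.of_algebraMap_eq fun _ => rfl
  have : IsScalarTower D₂ D A := IsScalarTower.of_algebraMap_eq fun _ => rfl
  let α₁ : B₁ →ₐ[D₁] A := (j₁.restrictScalars D₁).comp B₁.val
  let α₂ : B₂ →ₐ[D₂] A := (j₂.restrictScalars D₂).comp B₂.val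
  have hα (a : B₁) (b : B₂) : Commute (α₁ a) (α₂ b) := hc a b
  exact ⟨D, productSubalgebra D hα, hF.isCongenialWith (h₁.affine.sup h₂.affine) hc e he
    (fun _ => rfl) (fun _ => rfl) (isCommProduct_productSubalgebra hα) h₁ huniv h₂⟩

end Congenial

end AlgFiltration.IsProduct

theorem AlgFiltration.isProduct_tensor {k A₁ A₂ : Type*} [Field k] [Ring A₁] [Ring A₂]
    [Algebra k A₁] [Algebra k A₂] (F₁ : AlgFiltration k A₁) (F₂ : AlgFiltration k A₂) :
    IsProduct F₁ F₂ (F₁.tensor F₂) Algebra.TensorProduct.includeLeft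
      Algebra.TensorProduct.includeRight := by
  intro n
  change Submodule.span k _ = Submodule.span k _
  simp only [Algebra.TensorProduct.includeLeft_apply, Algebra.TensorProduct.includeRight_apply,
    Algebra.TensorProduct.tmul_mul_tmul, mul_one, one_mul]

theorem mainTheorem3 {k A₁ A₂ : Type u} [Field k] [Ring A₁] [Ring A₂] [Algebra k A₁] [Algebra k A₂]
    (F₁ : AlgFiltration k A₁) (F₂ : AlgFiltration k A₂)
    (D₁ : Subalgebra ℤ k) (B₁ : Subalgebra D₁ A₁)
    (h₁ : F₁.IsCongenialWith D₁ B₁)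
    (huniv : IsUniversallyNoetherian D₁ (F₁.induced B₁).Gr)
    (h₂ : F₂.IsCongenial) :
    (F₁.tensor F₂).IsCongenial := by
  obtain ⟨D₂, B₂, h₂⟩ := h₂
  have hmul (a : A₁) (b : A₂) :
      LinearEquiv.refl k (A₁ ⊗[k] A₂) (a ⊗ₜ b) = (a ⊗ₜ 1) * (1 ⊗ₜ b) := by
    rw [LinearEquiv.refl_apply, Algebra.TensorProduct.tmul_mul_tmul, mul_one, one_mul]
  have hcomm (a : A₁) (b : A₂) : Commute (a ⊗ₜ[k] (1 : A₂)) ((1 : A₁) ⊗ₜ[k] b) := by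
    simp only [Commute, SemiconjBy, Algebra.TensorProduct.tmul_mul_tmul, mul_one, one_mul]
  exact (AlgFiltration.isProduct_tensor F₁ F₂).isCongenial hcomm _ hmul h₁ huniv h₂
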